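/- Conventions. A von Neumann algebra on a complex Hilbert space $H$ is a $*$-subalgebra of $\mathcal B(H)$ equal to its double commutant; a W*-algebra is represented as a von Neumann algebra on some Hilbert space. A morphism is a unital $*$-homomorphism that is normal, i.e. continuous for the weak-$*$ (ultraweak) topologies. A representation of $E$ is a morphism $E\to\mathcal B(X)$ with $X$ a Hilbert space; it is faithful if it is injective, and irreducible if $X\neq 0$ and its only closed invariant subspaces are $0$ and $X$. The dimension $\dim X$ of a Hilbert space is the cardinality of an orthonormal basis. For von Neumann algebras $M\subseteq\mathcal B(H)$ and $N\subseteq\mathcal B(K)$, $M\,\overline\otimes\,N$ is the von Neumann algebra on the Hilbert space tensor product $H\otimes K$ generated by the operators $m\otimes n$ ($m\in M$, $n\in N$). A free exponential of $M$ and $N$ is a W*-algebra $M^{*N}$ with a morphism $\varepsilon: M\to M^{*N}\,\overline\otimes\,N$ such that for every W*-algebra $R$ and every morphism $\pi: M\to R\,\overline\otimes\,N$ there is a unique morphism $\rho: M^{*N}\to R$ with $\pi=(\rho\,\overline\otimes\,1)\circ\varepsilon$. A free product $M*N$ is a coproduct of $M$ and $N$ in the category of W*-algebras and morphisms. Both are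 determined up to canonical isomorphism. Proposition. Let $H$ and $K$ be complex Hilbert spaces. (1) If $M\subseteq\mathcal B(H)$ and $N\subseteq\mathcal B(K)$ are von Neumann algebras, then every free exponential $M^{*N}$ has a faithful representation on a Hilbert space of dimension at most $2^{\aleph_0\cdot\dim H\cdot\dim K}$. (2) If $\dim H\ge 2$ and $\dim K\ge 2$, then every faithful representation of $\mathcal B(H)^{*\mathcal B(K)}$ is on a Hilbert space of dimension at least $2^{\aleph_0\cdot\dim H\cdot\dim K}$. (3) If $\dim H\ge 2$ and $\dim K\ge 2$, then the free product $\mathcal B(H)*\mathcal B(K)$ has exactly $2^{\aleph_0\cdot\dim H\cdot\dim K}$ irreducible representations up to unitary equivalence. -/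

import Mathlib

universe u

open scoped TensorProduct InnerProductSpace Cardinal

noncomputable section

namespace WStar

/-! ### Hilbert space dimension -/

/-- The dimension of a Hilbert space: the cardinality of an orthonormal (Hilbert) basis. It does not
depend on the basis, see `mk_eq_hilbertDim`. -/
def hilbertDim (H : Type u) [NormedAddCommGroup H] [InnerProductSpace ℂ H] [CompleteSpace H] :
    Cardinal.{u} :=
  #(exists_hilbertBasis ℂ H).choose

theorem mk_le_of_hilbertBasis {H : Type u} [NormedAddCommGroup H] [InnerProductSpace ℂ H]
    {ι κ : Type u} [Infinite ι] (b : HilbertBasis ι ℂ H) (c : HilbertBasis κ ℂ H) : #κ ≤ #ι := by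
  have hcount : ∀ i, {j : κ | ⟪b i, c j⟫_ℂ ≠ 0}.Countable := fun i => by
    have h := (c.summable_inner_mul_inner (b i) (b i)).countable_support
    refine h.mono fun j hj => ?_
    simp only [Function.mem_support, ne_eq, mul_eq_zero, not_or]
    exact ⟨hj, fun h0 => hj (inner_eq_zero_symm.1 h0)⟩
  have hcover : (Set.univ : Set κ) ⊆ ⋃ i, {j : κ | ⟪b i, c j⟫_ℂ ≠ 0} := by
    intro j _
    by_contra hj
    simp only [Set.mem_iUnion, Set.mem_ofPred_eq, not_exists, not_not] at hj
    have h := b.tsum_inner_mul_inner (c j) (c j)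
    simp only [hj, mul_zero, tsum_zero] at h
    have h1 := c.orthonormal.1 j
    rw [inner_self_eq_zero.1 h.symm] at h1
    simp at h1
  calc #κ = #(Set.univ : Set κ) := Cardinal.mk_univ.symm
    _ ≤ #(⋃ i, {j : κ | ⟪b i, c j⟫_ℂ ≠ 0} : Set κ) := Cardinal.mk_le_mk_of_subset hcover
    _ ≤ #ι * ⨆ i, #({j : κ | ⟪b i, c j⟫_ℂ ≠ 0} : Set κ) := Cardinal.mk_iUnion_le _
    _ ≤ #ι * ℵ₀ := by
        gcongr
        exact ciSup_le' fun i => (hcount i).le_aleph0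
    _ = #ι := Cardinal.mul_aleph0_eq (Cardinal.aleph0_le_mk ι)

theorem finite_of_hilbertBasis {H : Type u} [NormedAddCommGroup H] [InnerProductSpace ℂ H]
    {ι κ : Type u} [Finite ι] (b : HilbertBasis ι ℂ H) (c : HilbertBasis κ ℂ H) : Finite κ := by
  have := Fintype.ofFinite ι
  have := b.toOrthonormalBasis.toBasis.finiteDimensional_of_finite
  exact c.orthonormal.linearIndependent.finite

theorem mk_eq_of_hilbertBasis {H : Type u} [NormedAddCommGroup H] [InnerProductSpace ℂ H]
    {ι κ : Type u} (b : HilbertBasis ι ℂ H) (c : HilbertBasis κ ℂ H) : #ι = #κ := by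
  rcases finite_or_infinite ι with hι | hι
  · have hκ := finite_of_hilbertBasis b c
    have := Fintype.ofFinite ι
    have := Fintype.ofFinite κ
    exact mk_eq_mk_of_basis' b.toOrthonormalBasis.toBasis c.toOrthonormalBasis.toBasis
  · rcases finite_or_infinite κ with hκ | hκ
    · exact absurd (finite_of_hilbertBasis c b) (not_finite_iff_infinite.2 hι)
    · exact le_antisymm (mk_le_of_hilbertBasis c b) (mk_le_of_hilbertBasis b c)

theorem mk_eq_hilbertDim {H : Type u} [NormedAddCommGroup H] [InnerProductSpace ℂ H]
    [CompleteSpace H] {ι : Type u} (b : HilbertBasis ι ℂ H) : #ι = hilbertDim H := by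
  obtain ⟨c, -⟩ := (exists_hilbertBasis ℂ H).choose_spec
  exact mk_eq_of_hilbertBasis b c

/-! ### Von Neumann algebras: generation, `B(H)`, spatial tensor product -/

section

variable {H : Type u} [NormedAddCommGroup H] [InnerProductSpace ℂ H] [CompleteSpace H]

/-- The von Neumann algebra generated by a set `s` of operators: the double commutant of
`s ∪ star s`. -/
def generated (s : Set (H →L[ℂ] H)) : VonNeumannAlgebra H where
  toStarSubalgebra :=
    StarSubalgebra.centralizer ℂ (StarSubalgebra.centralizer ℂ s : Set (H →L[ℂ] H))
  centralizer_centralizer' := by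
    simp

theorem subset_generated (s : Set (H →L[ℂ] H)) : s ⊆ (generated s : Set (H →L[ℂ] H)) :=
  (StarAlgebra.subset_adjoin ℂ s).trans (StarAlgebra.adjoin_le_centralizer_centralizer ℂ s)

theorem generated_le {s : Set (H →L[ℂ] H)} {S : VonNeumannAlgebra H}
    (h : s ⊆ (S : Set (H →L[ℂ] H))) : generated s ≤ S := by
  have h1 : s ∪ star s ⊆ (S : Set (H →L[ℂ] H)) :=
    Set.union_subset h fun x hx => by simpa using star_mem (h hx)
  intro x hx
  have h2 : x ∈ (s ∪ star s).centralizer.centralizer := by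
    rw [← StarSubalgebra.coe_centralizer_centralizer ℂ]
    exact hx
  have h3 := Set.centralizer_subset (Set.centralizer_subset h1) h2
  rw [S.centralizer_centralizer] at h3
  exact h3

variable (H) in
/-- The von Neumann algebra `B(H)` of all bounded operators on `H`. -/
def full : VonNeumannAlgebra H where
  toStarSubalgebra := ⊤
  centralizer_centralizer' := Set.eq_univ_of_univ_subset Set.subset_centralizer_centralizer

end

section

variable (H K : Type u)
  [NormedAddCommGroup H] [InnerProductSpace ℂ H] [NormedAddCommGroup K] [InnerProductSpace ℂ K]

/-- The Hilbert space tensor product `H ⊗ K`: the completion of the algebraic tensor product with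
respect to the inner product `⟪x ⊗ y, x' ⊗ y'⟫ = ⟪x, x'⟫ ⟪y, y'⟫`. -/
abbrev HilbertTensor : Type u := UniformSpace.Completion (H ⊗[ℂ] K)

variable {H K}

/-- The bounded operator `a ⊗ b` on `H ⊗ K`. -/
def opTensor (a : H →L[ℂ] H) (b : K →L[ℂ] K) : HilbertTensor H K →L[ℂ] HilbertTensor H K :=
  (TensorProduct.mapL a b).completion

theorem opTensor_tmul (a : H →L[ℂ] H) (b : K →L[ℂ] K) (x : H) (y : K) :
    opTensor a b ((x ⊗ₜ[ℂ] y : H ⊗[ℂ] K) : HilbertTensor H K) =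
      ((a x ⊗ₜ[ℂ] b y : H ⊗[ℂ] K) : HilbertTensor H K) := by
  simp [opTensor]

end

variable {H K L : Type u}
  [NormedAddCommGroup H] [InnerProductSpace ℂ H] [CompleteSpace H]
  [NormedAddCommGroup K] [InnerProductSpace ℂ K] [CompleteSpace K]
  [NormedAddCommGroup L] [InnerProductSpace ℂ L] [CompleteSpace L]

/-- The spatial tensor product of von Neumann algebras `M ⊆ B(H)` and `N ⊆ B(K)`: the von Neumann
algebra on `H ⊗ K` generated by the operators `m ⊗ n`. -/
def spatialTensor (M : VonNeumannAlgebra H) (N : VonNeumannAlgebra K) :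
    VonNeumannAlgebra (HilbertTensor H K) :=
  generated {t | ∃ m ∈ M, ∃ n ∈ N, t = opTensor m n}

/-- The element `m ⊗ n` of the spatial tensor product. -/
def elemTensor {M : VonNeumannAlgebra H} {N : VonNeumannAlgebra K}
    (m : M.toStarSubalgebra) (n : N.toStarSubalgebra) : (spatialTensor M N).toStarSubalgebra :=
  ⟨opTensor m.1 n.1, subset_generated _ ⟨m.1, m.2, n.1, n.2, rfl⟩⟩

/-! ### Morphisms -/

variable (H) in
/-- The ultraweak topology of `B(H)`, that is, its weak-* topology as the dual of the trace class
operators: the coarsest topology making all functionals `T ↦ ∑ₙ ⟪ηₙ, T ξₙ⟫` with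
`∑ₙ ‖ξₙ‖² < ∞` and `∑ₙ ‖ηₙ‖² < ∞` continuous. -/
abbrev ultraweak : TopologicalSpace (H →L[ℂ] H) :=
  ⨅ (ξ : ℕ → H) (η : ℕ → H) (_ : Summable fun n => ‖ξ n‖ ^ 2) (_ : Summable fun n => ‖η n‖ ^ 2),
    TopologicalSpace.induced (fun T : H →L[ℂ] H => ∑' n, ⟪η n, T (ξ n)⟫_ℂ) inferInstance

/-- The weak-* topology of a von Neumann algebra `M ⊆ B(H)`: the restriction of the ultraweak
topology of `B(H)`. -/
abbrev weakStar (M : VonNeumannAlgebra H) : TopologicalSpace M.toStarSubalgebra :=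
  (ultraweak H).induced Subtype.val

/-- Morphisms of W*-algebras: unital normal *-homomorphisms, where normal means continuous for the
weak-* topologies. -/
structure Morphism (M : VonNeumannAlgebra H) (N : VonNeumannAlgebra K) where
  /-- the underlying unital *-homomorphism -/
  hom : M.toStarSubalgebra →⋆ₐ[ℂ] N.toStarSubalgebra
  normal : @Continuous _ _ (weakStar M) (weakStar N) hom

instance (M : VonNeumannAlgebra H) (N : VonNeumannAlgebra K) :
    CoeFun (Morphism M N) (fun _ => M.toStarSubalgebra → N.toStarSubalgebra) where
  coe f := f.hom

/-! ### Free exponentials and free products -/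

/-- `Φ : E ⊗ N → R ⊗ N` is the morphism `ρ ⊗ 1`, i.e. `Φ (e ⊗ n) = ρ e ⊗ n`. (These elements
generate `E ⊗ N`, so there is at most one such morphism.) -/
def IsTensorId {E : VonNeumannAlgebra H} {R : VonNeumannAlgebra L} (N : VonNeumannAlgebra K)
    (ρ : Morphism E R) (Φ : Morphism (spatialTensor E N) (spatialTensor R N)) : Prop :=
  ∀ (e : E.toStarSubalgebra) (n : N.toStarSubalgebra), Φ (elemTensor e n) = elemTensor (ρ e) n

/-- `E`, with the coevaluation `ε : M → E ⊗ N`, is a free exponential of `M` and `N`: for every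
von Neumann algebra `R` and morphism `π : M → R ⊗ N` there is a unique morphism `ρ : E → R` such
that `π = (ρ ⊗ 1) ∘ ε`. -/
def IsFreeExponential (M : VonNeumannAlgebra H) (N : VonNeumannAlgebra K)
    (E : VonNeumannAlgebra L) (ε : Morphism M (spatialTensor E N)) : Prop :=
  ∀ (X : Type u) [NormedAddCommGroup X] [InnerProductSpace ℂ X] [CompleteSpace X]
    (R : VonNeumannAlgebra X) (π : Morphism M (spatialTensor R N)),
    ∃! ρ : Morphism E R, ∃ Φ : Morphism (spatialTensor E N) (spatialTensor R N),
      IsTensorId N ρ Φ ∧ ∀ m, π m = Φ (ε m)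

/-- `F`, with `i : M → F` and `j : N → F`, is a free product of `M` and `N`: their coproduct in the
category of W*-algebras and unital normal *-homomorphisms. -/
def IsFreeProduct (M : VonNeumannAlgebra H) (N : VonNeumannAlgebra K)
    (F : VonNeumannAlgebra L) (i : Morphism M F) (j : Morphism N F) : Prop :=
  ∀ (X : Type u) [NormedAddCommGroup X] [InnerProductSpace ℂ X] [CompleteSpace X]
    (R : VonNeumannAlgebra X) (f : Morphism M R) (g : Morphism N R),
    ∃! ρ : Morphism F R, (∀ m, ρ (i m) = f m) ∧ ∀ n, ρ (j n) = g n

/-! ### Representations -/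

/-- A (normal, unital) representation of `M` on a Hilbert space `X`. -/
structure Rep (M : VonNeumannAlgebra H) where
  X : Type u
  [normedAddCommGroup : NormedAddCommGroup X]
  [innerProductSpace : InnerProductSpace ℂ X]
  [completeSpace : CompleteSpace X]
  toMorphism : Morphism M (full X)

attribute [instance] Rep.normedAddCommGroup Rep.innerProductSpace Rep.completeSpace

namespace Rep

variable {M : VonNeumannAlgebra H}

/-- The operator by which `m` acts. -/
def op (π : Rep M) (m : M.toStarSubalgebra) : π.X →L[ℂ] π.X := (π.toMorphism m).1

/-- The dimension of the Hilbert space of a representation. -/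
def dim (π : Rep M) : Cardinal.{u} := hilbertDim π.X

def Faithful (π : Rep M) : Prop := Function.Injective π.op

/-- A representation on a nonzero Hilbert space is irreducible if the only closed invariant
subspaces are the trivial ones. -/
def Irreducible (π : Rep M) : Prop :=
  Nontrivial π.X ∧ ∀ V : Submodule ℂ π.X, IsClosed (V : Set π.X) →
    (∀ m, ∀ x ∈ V, π.op m x ∈ V) → V = ⊥ ∨ V = ⊤

def UnitarilyEquiv (π σ : Rep M) : Prop :=
  ∃ U : π.X ≃ₗᵢ[ℂ] σ.X, ∀ m x, U (π.op m x) = σ.op m (U x)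

end Rep

/-- Unitary equivalence of irreducible representations. -/
def irrepSetoid (M : VonNeumannAlgebra H) : Setoid {π : Rep M // π.Irreducible} where
  r π σ := π.1.UnitarilyEquiv σ.1
  iseqv :=
    { refl := fun _ => ⟨LinearIsometryEquiv.refl ℂ _, fun _ _ => rfl⟩
      symm := fun {π σ} ⟨U, hU⟩ => ⟨U.symm, fun m x => by
        rw [LinearIsometryEquiv.symm_apply_eq, hU, LinearIsometryEquiv.apply_symm_apply]⟩
      trans := fun ⟨U, hU⟩ ⟨V, hV⟩ => ⟨U.trans V, fun m x => by simp [hU, hV]⟩ }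

/-- Unitary equivalence classes of irreducible representations of `M`. -/
def IrrepClass (M : VonNeumannAlgebra H) : Type (u + 1) := Quotient (irrepSetoid M)

end WStar

end

open scoped TensorProduct InnerProductSpace Cardinal

noncomputable section

set_option linter.unusedSectionVars false

namespace WStar

/-! ### The Hilbert space tensor product -/

section Tensor

variable {H K : Type u}
  [NormedAddCommGroup H] [InnerProductSpace ℂ H] [NormedAddCommGroup K] [InnerProductSpace ℂ K]

/-! Put `κ = ℵ₀ · dim H · dim K`.

Upper bounds. A von Neumann algebra on `H ≠ 0` has a star-closed ultraweakly dense subset of size at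
most `ℵ₀ · dim H` (`exists_dense_set`). For a free exponential `E` on `L`, take the blocks along a
basis of `K` of the images under `ε` of such a set: at most `κ` operators. If a unitary `u` commutes
with all of them, then `Ad u` and the inclusion `E ⊆ B(L)` solve the same universal problem, so `u`
commutes with `E`. Since unitaries span the commutant, whatever commutes with the blocks commutes
with `E` (`IsFreeExponential.commute_of_slice`). A vector `x` is determined, up to an intertwiner,
by its moments `⟪x, w x⟫` on words `w` in these operators, and there are at most `2 ^ κ` moment
functionals. Choosing one vector for each that occurs and closing up under the operators gives an
invariant subspace of dimension at most `2 ^ κ` on which `E` acts faithfully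
(`exists_faithful_rep`). For the free product, dense subsets of both factors take the place of the
blocks; a nonzero vector of an irreducible representation is cyclic, so its moments determine the
unitary class.

Lower bounds. For each matrix `θ` of phases, trivial on one row and one column, let `D` be the
corresponding diagonal unitary of `H ⊗ K`. The twists `D* (a ⊗ 1) D` give morphisms from the free
exponential to `B(H)`, and the pairs `a ⊗ 1`, `D (1 ⊗ b) D*` give representations of the free
product. Comparing matrix entries (`eq_smul_one_of_commute`) shows that intertwiners between
different twists vanish and that self-intertwiners are scalars. There are at least `2 ^ κ` such `θ`
(`le_mk_phase`). For the free product this yields inequivalent irreducibles. For the free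
exponential it yields pairwise disjoint representations, whose isotypic projections are nonzero,
mutually orthogonal and lie in `E`; a faithful representation must keep them nonzero and therefore
needs that many dimensions (`Rep.Faithful.mk_le_dim`). -/

/-- The operator `x ↦ x ⊗ y`. -/
def tmulRight (H : Type u) [NormedAddCommGroup H] [InnerProductSpace ℂ H] (y : K) :
    H →L[ℂ] HilbertTensor H K :=
  UniformSpace.Completion.toComplL ∘L (TensorProduct.mkL ℂ H K).flip y

/-- The operator `y ↦ x ⊗ y`. -/
def tmulLeft (K : Type u) [NormedAddCommGroup K] [InnerProductSpace ℂ K] (x : H) :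
    K →L[ℂ] HilbertTensor H K :=
  UniformSpace.Completion.toComplL ∘L (TensorProduct.mkL ℂ H K) x

theorem opTensor_tmulRight (a : H →L[ℂ] H) (b : K →L[ℂ] K) (x : H) (y : K) :
    opTensor a b (tmulRight H y x) = tmulRight H (b y) (a x) :=
  opTensor_tmul a b x y

theorem tmulRight_add_right (y y' : K) : tmulRight H (y + y') = tmulRight H y + tmulRight H y' := by
  simp [tmulRight]

theorem tmulRight_smul_right (r : ℂ) (y : K) : tmulRight H (r • y) = r • tmulRight H y := by
  simp [tmulRight]

theorem opTensor_one_tmulRight (a : H →L[ℂ] H) (x : H) (y : K) :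
    opTensor a 1 (tmulRight H y x) = tmulRight H y (a x) :=
  opTensor_tmulRight a 1 x y

theorem inner_tmulRight (x x' : H) (y y' : K) :
    ⟪tmulRight H y x, tmulRight H y' x'⟫_ℂ = ⟪x, x'⟫_ℂ * ⟪y, y'⟫_ℂ := by
  have h : ∀ (x : H) (y : K), tmulRight H y x = ((x ⊗ₜ[ℂ] y : H ⊗[ℂ] K) : HilbertTensor H K) :=
    fun _ _ => rfl
  rw [h, h, UniformSpace.Completion.inner_coe, TensorProduct.inner_tmul]

theorem norm_tmulRight (x : H) (y : K) : ‖tmulRight H y x‖ = ‖x‖ * ‖y‖ := by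
  have h : tmulRight H y x = ((x ⊗ₜ[ℂ] y : H ⊗[ℂ] K) : HilbertTensor H K) := rfl
  rw [h, UniformSpace.Completion.norm_coe, TensorProduct.norm_tmul]

theorem dense_span_tmulRight :
    (Submodule.span ℂ {t | ∃ (x : H) (y : K), t = tmulRight H y x}).topologicalClosure = ⊤ := by
  rw [Submodule.eq_top_iff']
  intro t
  induction t using UniformSpace.Completion.induction_on with
  | hp => exact Submodule.isClosed_topologicalClosure _
  | ih t =>
    induction t using TensorProduct.induction_on with
    | zero => exact zero_mem _
    | tmul x y => exact Submodule.le_topologicalClosure _ (Submodule.subset_span ⟨x, y, rfl⟩)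
    | add s t hs ht => rw [UniformSpace.Completion.coe_add]; exact add_mem hs ht

/-- The Hilbert basis `bᵢ ⊗ cⱼ` of `H ⊗ K`. -/
def tensorBasis {ι κ : Type*} (b : HilbertBasis ι ℂ H) (c : HilbertBasis κ ℂ K) :
    HilbertBasis (ι × κ) ℂ (HilbertTensor H K) :=
  HilbertBasis.mk (v := fun p => tmulRight H (c p.2) (b p.1))
    (by
      classical
      rw [orthonormal_iff_ite]
      rintro ⟨i, j⟩ ⟨i', j'⟩
      rw [inner_tmulRight, orthonormal_iff_ite.1 b.orthonormal, orthonormal_iff_ite.1 c.orthonormal]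
      simp only [Prod.ext_iff, ite_and]
      split_ifs <;> simp)
    (by
      rw [← dense_span_tmulRight]
      refine Submodule.topologicalClosure_minimal _ (Submodule.span_le.2 ?_)
        (Submodule.isClosed_topologicalClosure _)
      set S := (Submodule.span ℂ (Set.range fun p : ι × κ =>
        tmulRight H (c p.2) (b p.1))).topologicalClosure
      have hS : IsClosed (S : Set (HilbertTensor H K)) := Submodule.isClosed_topologicalClosure _
      -- Density is checked one factor at a time: arbitrary `x` against basis vectors of `K`, then
      -- arbitrary `y`.
      have h1 : ∀ x j, tmulRight H (c j) x ∈ S := by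
        intro x j
        have : (⊤ : Submodule ℂ H) ≤ S.comap (tmulRight H (c j)).toLinearMap := by
          rw [← b.dense_span]
          refine Submodule.topologicalClosure_minimal _ (Submodule.span_le.2 ?_)
            (hS.preimage (tmulRight H (c j)).continuous)
          rintro _ ⟨i, rfl⟩
          exact Submodule.le_topologicalClosure _ (Submodule.subset_span ⟨(i, j), rfl⟩)
        exact this (Submodule.mem_top (x := x))
      rintro _ ⟨x, y, rfl⟩
      have : (⊤ : Submodule ℂ K) ≤ S.comap (tmulLeft K x).toLinearMap := by
        rw [← c.dense_span]
        refine Submodule.topologicalClosure_minimal _ (Submodule.span_le.2 ?_)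
          (hS.preimage (tmulLeft K x).continuous)
        rintro _ ⟨j, rfl⟩
        exact h1 x j
      exact this (Submodule.mem_top (x := y)))

theorem tensorBasis_apply {ι κ : Type*} (b : HilbertBasis ι ℂ H) (c : HilbertBasis κ ℂ K)
    (p : ι × κ) : tensorBasis b c p = tmulRight H (c p.2) (b p.1) := by
  simp [tensorBasis]

/-- Bounded operators that agree on a Hilbert basis are equal. -/
theorem ext_hilbertBasis {X Y : Type*} [NormedAddCommGroup X] [InnerProductSpace ℂ X]
    [NormedAddCommGroup Y] [NormedSpace ℂ Y] {ι : Type*} (b : HilbertBasis ι ℂ X)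
    {S T : X →L[ℂ] Y} (h : ∀ i, S (b i) = T (b i)) : S = T := by
  refine ContinuousLinearMap.ext_on (s := Set.range b) ?_ ?_
  · rw [Submodule.dense_iff_topologicalClosure_eq_top, b.dense_span]
  · rintro _ ⟨i, rfl⟩
    exact h i

/-- Vectors with the same coordinates in a Hilbert basis are equal. -/
theorem ext_inner_hilbertBasis {X : Type*} [NormedAddCommGroup X] [InnerProductSpace ℂ X]
    {ι : Type*} (b : HilbertBasis ι ℂ X) {x y : X} (h : ∀ i, ⟪b i, x⟫_ℂ = ⟪b i, y⟫_ℂ) :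
    x = y := by
  apply b.repr.injective
  ext i
  rw [b.repr_apply_apply, b.repr_apply_apply, h]

/-- Every Hilbert space has a Hilbert basis indexed in its own universe. -/
theorem exists_basis (X : Type u) [NormedAddCommGroup X] [InnerProductSpace ℂ X]
    [CompleteSpace X] : ∃ (ι : Type u), Nonempty (HilbertBasis ι ℂ X) := by
  obtain ⟨w, b, -⟩ := exists_hilbertBasis ℂ X
  exact ⟨w, ⟨b⟩⟩

variable [CompleteSpace H] [CompleteSpace K]

theorem ext_tmulRight {Y : Type*} [NormedAddCommGroup Y] [NormedSpace ℂ Y]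
    {S T : HilbertTensor H K →L[ℂ] Y}
    (h : ∀ x y, S (tmulRight H y x) = T (tmulRight H y x)) : S = T := by
  obtain ⟨ι, ⟨b⟩⟩ := exists_basis H
  obtain ⟨κ, ⟨c⟩⟩ := exists_basis K
  refine ext_hilbertBasis (tensorBasis b c) fun p => ?_
  rw [tensorBasis_apply]
  exact h _ _

theorem opTensor_mul (a a' : H →L[ℂ] H) (b b' : K →L[ℂ] K) :
    opTensor a b * opTensor a' b' = opTensor (a * a') (b * b') :=
  ext_tmulRight fun x y => by simp [opTensor_tmulRight]

theorem opTensor_one : opTensor (1 : H →L[ℂ] H) (1 : K →L[ℂ] K) = 1 :=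
  ext_tmulRight fun x y => by simp [opTensor_tmulRight]

theorem opTensor_add_left (a a' : H →L[ℂ] H) (b : K →L[ℂ] K) :
    opTensor (a + a') b = opTensor a b + opTensor a' b :=
  ext_tmulRight fun x y => by simp [opTensor_tmulRight]

theorem opTensor_smul_left (r : ℂ) (a : H →L[ℂ] H) (b : K →L[ℂ] K) :
    opTensor (r • a) b = r • opTensor a b :=
  ext_tmulRight fun x y => by simp [opTensor_tmulRight]

theorem opTensor_zero_left (b : K →L[ℂ] K) : opTensor (0 : H →L[ℂ] H) b = 0 :=
  ext_tmulRight fun x y => by simp [opTensor_tmulRight]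

theorem opTensor_add_right (a : H →L[ℂ] H) (b b' : K →L[ℂ] K) :
    opTensor a (b + b') = opTensor a b + opTensor a b' :=
  ext_tmulRight fun x y => by simp [opTensor_tmulRight, tmulRight_add_right]

theorem opTensor_smul_right (r : ℂ) (a : H →L[ℂ] H) (b : K →L[ℂ] K) :
    opTensor a (r • b) = r • opTensor a b :=
  ext_tmulRight fun x y => by simp [opTensor_tmulRight, tmulRight_smul_right]

theorem opTensor_zero_right (a : H →L[ℂ] H) : opTensor a (0 : K →L[ℂ] K) = 0 := by
  simpa using opTensor_smul_right 0 a (0 : K →L[ℂ] K)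

theorem star_opTensor (a : H →L[ℂ] H) (b : K →L[ℂ] K) :
    star (opTensor a b) = opTensor (star a) (star b) := by
  refine ext_tmulRight fun x y => ?_
  obtain ⟨ι, ⟨e⟩⟩ := exists_basis H
  obtain ⟨κ, ⟨f⟩⟩ := exists_basis K
  refine ext_inner_hilbertBasis (tensorBasis e f) fun p => ?_
  simp only [ContinuousLinearMap.star_eq_adjoint, ContinuousLinearMap.adjoint_inner_right,
    tensorBasis_apply, opTensor_tmulRight, inner_tmulRight]

/-- The block `⟨y, y'⟩`-entry `V_y* T V_y'` of an operator on `H ⊗ K`. -/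
def slice (y y' : K) (T : HilbertTensor H K →L[ℂ] HilbertTensor H K) : H →L[ℂ] H :=
  (ContinuousLinearMap.adjoint (tmulRight H y)) ∘L T ∘L tmulRight H y'

theorem inner_slice (y y' : K) (T : HilbertTensor H K →L[ℂ] HilbertTensor H K) (x x' : H) :
    ⟪x, slice y y' T x'⟫_ℂ = ⟪tmulRight H y x, T (tmulRight H y' x')⟫_ℂ := by
  simp [slice, ContinuousLinearMap.adjoint_inner_right]

theorem star_slice (y y' : K) (T : HilbertTensor H K →L[ℂ] HilbertTensor H K) :
    star (slice y y' T) = slice y' y (star T) := by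
  refine ContinuousLinearMap.ext fun x => ext_inner_left ℂ fun v => ?_
  rw [ContinuousLinearMap.star_eq_adjoint, ContinuousLinearMap.adjoint_inner_right, inner_slice,
    ← inner_conj_symm, inner_slice, inner_conj_symm, ContinuousLinearMap.star_eq_adjoint,
    ContinuousLinearMap.adjoint_inner_right]

/-- This is the adjoint of `opTensor_one_tmulRight` for `star a`. It lets factors `a ⊗ 1` be pulled
out of blocks, so that commutation with `a ⊗ 1` can be tested block by block. -/
theorem adjoint_tmulRight_opTensor (y : K) (a : H →L[ℂ] H) (t : HilbertTensor H K) :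
    ContinuousLinearMap.adjoint (tmulRight H y) (opTensor a 1 t) =
      a (ContinuousLinearMap.adjoint (tmulRight H y) t) := by
  refine ext_inner_left ℂ fun v => ?_
  rw [ContinuousLinearMap.adjoint_inner_right, ← ContinuousLinearMap.adjoint_inner_left,
    ← ContinuousLinearMap.star_eq_adjoint, star_opTensor, star_one, opTensor_one_tmulRight,
    ← ContinuousLinearMap.adjoint_inner_right, ContinuousLinearMap.star_eq_adjoint,
    ContinuousLinearMap.adjoint_inner_left]

theorem slice_mul_opTensor (y y' : K) (T : HilbertTensor H K →L[ℂ] HilbertTensor H K)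
    (a : H →L[ℂ] H) : slice y y' (T * opTensor a 1) = slice y y' T * a := by
  ext x
  simp [slice, opTensor_one_tmulRight]

theorem slice_opTensor_mul (y y' : K) (T : HilbertTensor H K →L[ℂ] HilbertTensor H K)
    (a : H →L[ℂ] H) : slice y y' (opTensor a 1 * T) = a * slice y y' T := by
  ext x
  simp [slice, adjoint_tmulRight_opTensor]

/-- An operator on `H ⊗ K` is determined by its blocks. -/
theorem ext_slice {κ : Type*} (c : HilbertBasis κ ℂ K)
    {S T : HilbertTensor H K →L[ℂ] HilbertTensor H K}
    (h : ∀ j j', slice (c j) (c j') S = slice (c j) (c j') T) : S = T := by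
  obtain ⟨ι, ⟨b⟩⟩ := exists_basis H
  refine ext_hilbertBasis (tensorBasis b c) fun p => ext_inner_hilbertBasis (tensorBasis b c)
    fun q => ?_
  rw [tensorBasis_apply, tensorBasis_apply, ← inner_slice, ← inner_slice, h]

/-- `T` commutes with `a ⊗ 1` if its blocks commute with `a`. -/
theorem commute_opTensor_of_slice {κ : Type*} (c : HilbertBasis κ ℂ K)
    {T : HilbertTensor H K →L[ℂ] HilbertTensor H K} {a : H →L[ℂ] H}
    (h : ∀ j j', Commute (slice (c j) (c j') T) a) : Commute T (opTensor a 1) :=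
  ext_slice c fun j j' => by rw [slice_mul_opTensor, slice_opTensor_mul, (h j j').eq]

theorem commute_slice {T : HilbertTensor H K →L[ℂ] HilbertTensor H K} {a : H →L[ℂ] H}
    (h : Commute T (opTensor a 1)) (y y' : K) : Commute (slice y y' T) a := by
  rw [Commute, SemiconjBy, ← slice_mul_opTensor, ← slice_opTensor_mul, h.eq]

/-- The inner product of `H ⊗ K` in blocks. -/
theorem hasSum_inner_adjoint_tmulRight {κ : Type*} (c : HilbertBasis κ ℂ K)
    (s t : HilbertTensor H K) :
    HasSum (fun j => ⟪ContinuousLinearMap.adjoint (tmulRight H (c j)) s,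
      ContinuousLinearMap.adjoint (tmulRight H (c j)) t⟫_ℂ) ⟪s, t⟫_ℂ := by
  obtain ⟨ι, ⟨b⟩⟩ := exists_basis H
  have h1 := (tensorBasis b c).hasSum_inner_mul_inner s t
  -- With `κ` as the outer index, the inner sums over `ι` are the inner products of the blocks.
  rw [← (Equiv.prodComm κ ι).hasSum_iff] at h1
  refine HasSum.prod_fiberwise h1 fun j => ?_
  have h2 := b.hasSum_inner_mul_inner (ContinuousLinearMap.adjoint (tmulRight H (c j)) s)
    (ContinuousLinearMap.adjoint (tmulRight H (c j)) t)
  simp_rw [ContinuousLinearMap.adjoint_inner_right, ContinuousLinearMap.adjoint_inner_left] at h2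
  rw [← ContinuousLinearMap.adjoint_inner_right] at h2
  simpa [tensorBasis_apply, Function.comp_def] using h2

theorem summable_norm_adjoint_tmulRight {κ : Type*} (c : HilbertBasis κ ℂ K)
    (t : HilbertTensor H K) :
    Summable fun j => ‖ContinuousLinearMap.adjoint (tmulRight H (c j)) t‖ ^ 2 := by
  have h := (hasSum_inner_adjoint_tmulRight c t t).summable
  simp only [inner_self_eq_norm_sq_to_K] at h
  exact_mod_cast h

theorem hasSum_norm_adjoint_tmulRight {κ : Type*} (c : HilbertBasis κ ℂ K)
    (t : HilbertTensor H K) :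
    HasSum (fun j => ‖ContinuousLinearMap.adjoint (tmulRight H (c j)) t‖ ^ 2) (‖t‖ ^ 2) := by
  have h := hasSum_inner_adjoint_tmulRight c t t
  simp only [inner_self_eq_norm_sq_to_K] at h
  exact_mod_cast h

/-- A square summable family of vectors of `H` is a vector of `H ⊗ ℓ²`. -/
theorem exists_adjoint_tmulRight_eq {κ : Type*} (c : HilbertBasis κ ℂ K) (x : κ → H)
    (hx : Summable fun j => ‖x j‖ ^ 2) :
    ∃ t : HilbertTensor H K, ∀ j, ContinuousLinearMap.adjoint (tmulRight H (c j)) t = x j := by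
  classical
  have hc := orthonormal_iff_ite.1 c.orthonormal
  -- The maps `y ↦ y ⊗ c j` are isometries with orthogonal ranges, so square summability is exactly
  -- convergence of `∑ x j ⊗ c j`.
  let V : κ → H →ₗᵢ[ℂ] HilbertTensor H K := fun j =>
    ⟨(tmulRight H (c j)).toLinearMap, fun y => by
      simp [norm_tmulRight, c.orthonormal.1 j]⟩
  have hV : OrthogonalFamily ℂ (fun _ : κ => H) V := by
    intro j j' hj y y'
    simp [V, inner_tmulRight, hc, hj]
  have hs : Summable fun j => V j (x j) := (hV.summable_iff_norm_sq_summable x).2 hx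
  refine ⟨∑' j, V j (x j), fun j => ?_⟩
  rw [ContinuousLinearMap.map_tsum _ hs, tsum_eq_single j]
  · refine ext_inner_left ℂ fun v => ?_
    simp [V, ContinuousLinearMap.adjoint_inner_right, inner_tmulRight, c.orthonormal.1 j]
  · intro j' hj
    refine ext_inner_left ℂ fun v => ?_
    simp [V, ContinuousLinearMap.adjoint_inner_right, inner_tmulRight, hc, hj.symm]

end Tensor

/-! ### The ultraweak topology -/

section Ultraweak

variable {H K : Type u}
  [NormedAddCommGroup H] [InnerProductSpace ℂ H] [CompleteSpace H]
  [NormedAddCommGroup K] [InnerProductSpace ℂ K] [CompleteSpace K]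

/-- Cauchy–Schwarz with the product replaced by a sum of squares: the right side is directly a
dominating series for square summable families. -/
theorem norm_inner_apply_le (T : H →L[ℂ] H) (x y : H) :
    ‖⟪y, T x⟫_ℂ‖ ≤ ‖T‖ * (‖x‖ ^ 2 + ‖y‖ ^ 2) := by
  have h1 : ‖⟪y, T x⟫_ℂ‖ ≤ ‖y‖ * (‖T‖ * ‖x‖) :=
    (norm_inner_le_norm _ _).trans (by gcongr; exact T.le_opNorm x)
  nlinarith [norm_nonneg T, mul_nonneg (norm_nonneg T) (sq_nonneg (‖x‖ - ‖y‖)),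
    mul_nonneg (norm_nonneg T) (add_nonneg (sq_nonneg ‖x‖) (sq_nonneg ‖y‖))]

theorem summable_inner_apply {ι : Type*} (T : H →L[ℂ] H) {x y : ι → H}
    (hx : Summable fun i => ‖x i‖ ^ 2) (hy : Summable fun i => ‖y i‖ ^ 2) :
    Summable fun i => ⟪y i, T (x i)⟫_ℂ :=
  Summable.of_norm_bounded ((hx.add hy).mul_left ‖T‖) fun i => norm_inner_apply_le T (x i) (y i)

theorem continuous_ultraweak_seq {ξ η : ℕ → H} (hξ : Summable fun n => ‖ξ n‖ ^ 2)
    (hη : Summable fun n => ‖η n‖ ^ 2) :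
    @Continuous _ _ (ultraweak H) _ fun T : H →L[ℂ] H => ∑' n, ⟪η n, T (ξ n)⟫_ℂ := by
  rw [continuous_iff_le_induced]
  exact iInf_le_of_le ξ (iInf_le_of_le η (iInf_le_of_le hξ (iInf_le_of_le hη le_rfl)))

theorem continuous_ultraweak_rng {Z : Type*} {tZ : TopologicalSpace Z} {f : Z → H →L[ℂ] H}
    (h : ∀ ξ η : ℕ → H, (Summable fun n => ‖ξ n‖ ^ 2) → (Summable fun n => ‖η n‖ ^ 2) →
      Continuous fun z => ∑' n, ⟪η n, f z (ξ n)⟫_ℂ) : @Continuous _ _ tZ (ultraweak H) f := by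
  simp only [continuous_iInf_rng, continuous_induced_rng]
  exact h

/-- A square summable family has countable support, so after padding with zeros it is a sequence.
Arbitrary index sets are needed because bases of `K` may be uncountable. -/
theorem continuous_ultraweak_tsum {ι : Type*} {ξ η : ι → H} (hξ : Summable fun i => ‖ξ i‖ ^ 2)
    (hη : Summable fun i => ‖η i‖ ^ 2) :
    @Continuous _ _ (ultraweak H) _ fun T : H →L[ℂ] H => ∑' i, ⟪η i, T (ξ i)⟫_ℂ := by
  classical
  set S : Set ι := Function.support fun i => ‖ξ i‖ ^ 2
  have hS : S.Countable := hξ.countable_support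
  have : Countable S := hS.to_subtype
  obtain ⟨f, hf⟩ := exists_injective_nat S
  have key : ∀ (x : ι → H), (Summable fun i => ‖x i‖ ^ 2) →
      Summable fun n => ‖Function.extend f (fun s : S => x s) 0 n‖ ^ 2 := by
    intro x hx
    rw [← hf.summable_iff]
    · simpa [Function.comp_def, hf.extend_apply] using hx.comp_injective Subtype.val_injective
    · intro n hn
      rw [Function.extend_apply' _ _ _ (by simpa using hn)]
      simp
  have h := continuous_ultraweak_seq (key ξ hξ) (key η hη)
  convert h using 2 with T
  rw [← hf.tsum_eq]
  · simp only [hf.extend_apply]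
    refine (tsum_subtype_eq_of_support_subset (f := fun i => ⟪η i, T (ξ i)⟫_ℂ) ?_).symm
    intro i hi
    simp only [Function.mem_support, ne_eq] at hi
    simp only [S, Function.mem_support, ne_eq]
    contrapose! hi
    have : ξ i = 0 := by simpa using hi
    simp [this]
  · intro n hn
    by_contra h'
    apply hn
    simp only [Set.mem_range, not_exists] at h'
    simp only
    rw [Function.extend_apply' _ _ _ (by simpa only [not_exists] using h')]
    simp

theorem continuous_ultraweak_inner (x y : H) :
    @Continuous _ _ (ultraweak H) _ fun T : H →L[ℂ] H => ⟪y, T x⟫_ℂ := by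
  have h := continuous_ultraweak_tsum (ι := Unit) (ξ := fun _ => x) (η := fun _ => y)
    (Summable.of_finite) (Summable.of_finite)
  simpa using h

/-- Moving `A` to the other slot as its adjoint turns a defining functional on `B(K)` into one on
`B(H)`, since bounded operators preserve square summability. -/
theorem continuous_ultraweak_conj (A : H →L[ℂ] K) (B : K →L[ℂ] H) :
    @Continuous _ _ (ultraweak H) (ultraweak K) fun T : H →L[ℂ] H => A ∘L T ∘L B := by
  have key : ∀ {X Y : Type u} [NormedAddCommGroup X] [NormedSpace ℂ X]
      [NormedAddCommGroup Y] [NormedSpace ℂ Y] (C : X →L[ℂ] Y) (x : ℕ → X),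
      (Summable fun n => ‖x n‖ ^ 2) → Summable fun n => ‖C (x n)‖ ^ 2 := by
    intro X Y _ _ _ _ C x hx
    refine Summable.of_nonneg_of_le (fun n => by positivity) (fun n => ?_)
      (hx.mul_left (‖C‖ ^ 2))
    rw [← mul_pow]
    gcongr
    exact C.le_opNorm _
  refine continuous_ultraweak_rng (tZ := ultraweak H) fun ξ η hξ hη => ?_
  have h := continuous_ultraweak_seq (key B ξ hξ) (key (ContinuousLinearMap.adjoint A) η hη)
  simpa [ContinuousLinearMap.adjoint_inner_left] using h

/-- Splitting each vector of `H ⊗ K` into blocks along a basis of `K` preserves the sum of squared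
norms, so defining functionals on `B(H ⊗ K)` pull back to sums over `ℕ × κ` of the same kind. -/
theorem continuous_ultraweak_opTensor :
    @Continuous _ _ (ultraweak H) (ultraweak (HilbertTensor H K))
      fun T : H →L[ℂ] H => opTensor T (1 : K →L[ℂ] K) := by
  refine continuous_ultraweak_rng (tZ := ultraweak H) fun ξ η hξ hη => ?_
  obtain ⟨κ, ⟨c⟩⟩ := exists_basis K
  have key : ∀ (x : ℕ → HilbertTensor H K), (Summable fun n => ‖x n‖ ^ 2) →
      Summable fun p : ℕ × κ =>
        ‖ContinuousLinearMap.adjoint (tmulRight H (c p.2)) (x p.1)‖ ^ 2 := by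
    intro x hx
    rw [summable_prod_of_nonneg (fun p => by positivity)]
    refine ⟨fun n => summable_norm_adjoint_tmulRight c (x n), ?_⟩
    simpa only [(hasSum_norm_adjoint_tmulRight c _).tsum_eq] using hx
  have h := continuous_ultraweak_tsum (key ξ hξ) (key η hη)
  convert h using 2 with T
  have hs := summable_inner_apply T (key ξ hξ) (key η hη)
  rw [hs.tsum_prod]
  refine tsum_congr fun n => ?_
  rw [← (hasSum_inner_adjoint_tmulRight c _ _).tsum_eq]
  simp only [adjoint_tmulRight_opTensor]

/-- The flip `H ⊗ K → K ⊗ H`. -/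
def tensorFlip (H K : Type u) [NormedAddCommGroup H] [InnerProductSpace ℂ H]
    [NormedAddCommGroup K] [InnerProductSpace ℂ K] : HilbertTensor H K →L[ℂ] HilbertTensor K H :=
  ((TensorProduct.commIsometry ℂ H K).toContinuousLinearEquiv : _ →L[ℂ] _).completion

theorem tensorFlip_tmulRight (x : H) (y : K) :
    tensorFlip H K (tmulRight H y x) = tmulRight K x y := by
  have h : tmulRight H y x = ((x ⊗ₜ[ℂ] y : H ⊗[ℂ] K) : HilbertTensor H K) := rfl
  rw [h, tensorFlip]
  simp
  rfl

theorem opTensor_one_left (b : K →L[ℂ] K) :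
    opTensor (1 : H →L[ℂ] H) b = tensorFlip K H ∘L opTensor b 1 ∘L tensorFlip H K :=
  ext_tmulRight fun x y => by
    simp [opTensor_tmulRight, tensorFlip_tmulRight]

theorem continuous_ultraweak_opTensor_right :
    @Continuous _ _ (ultraweak K) (ultraweak (HilbertTensor H K))
      fun T : K →L[ℂ] K => opTensor (1 : H →L[ℂ] H) T := by
  simp only [opTensor_one_left]
  exact @Continuous.comp _ _ _ (ultraweak K) (ultraweak (HilbertTensor K H))
    (ultraweak (HilbertTensor H K)) _ _ (continuous_ultraweak_conj _ _)
    continuous_ultraweak_opTensor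

/-- An ultraweakly continuous functional on a von Neumann algebra is of the form
`m ↦ ∑ₙ ⟪ηₙ, m ξₙ⟫` with square summable `ξ` and `η`. -/
theorem exists_seq_of_continuous {M : VonNeumannAlgebra H} (φ : M.toStarSubalgebra →ₗ[ℂ] ℂ)
    (hφ : @Continuous _ _ (weakStar M) _ φ) :
    ∃ ξ η : ℕ → H, (Summable fun n => ‖ξ n‖ ^ 2) ∧ (Summable fun n => ‖η n‖ ^ 2) ∧
      ∀ m, φ m = ∑' n, ⟪η n, m.1 (ξ n)⟫_ℂ := by
  let ι := {p : (ℕ → H) × (ℕ → H) //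
    (Summable fun n => ‖p.1 n‖ ^ 2) ∧ (Summable fun n => ‖p.2 n‖ ^ 2)}
  let f : ι → M.toStarSubalgebra →ₗ[ℂ] ℂ := fun p =>
    { toFun := fun m => ∑' n, ⟪p.1.2 n, m.1 (p.1.1 n)⟫_ℂ
      map_add' := fun m m' => by
        rw [← (summable_inner_apply m.1 p.2.1 p.2.2).tsum_add
          (summable_inner_apply m'.1 p.2.1 p.2.2)]
        exact tsum_congr fun n => by simp
      map_smul' := fun r m => by
        simp only [RingHom.id_apply, smul_eq_mul]
        rw [← tsum_mul_left]
        exact tsum_congr fun n => by simp }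
  have ht : weakStar M = ⨅ p, TopologicalSpace.induced (f p) inferInstance := by
    simp only [weakStar, ultraweak, induced_iInf, induced_compose]
    refine le_antisymm (le_iInf fun p => ?_) ?_
    · exact iInf_le_of_le p.1.1 (iInf_le_of_le p.1.2
        (iInf_le_of_le p.2.1 (iInf_le_of_le p.2.2 le_rfl)))
    · exact le_iInf fun ξ => le_iInf fun η => le_iInf fun hξ => le_iInf fun hη =>
        iInf_le_of_le ⟨(ξ, η), hξ, hη⟩ le_rfl
  rw [ht] at hφ
  -- The weak-* topology is the initial topology of the functionals `f p`; a continuous linear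
  -- functional is therefore a finite linear combination of them.
  have hmem := (LinearMap.mem_span_iff_continuous φ).2 hφ
  clear hφ ht
  induction hmem using Submodule.span_induction with
  | mem φ h =>
    obtain ⟨p, rfl⟩ := h
    exact ⟨p.1.1, p.1.2, p.2.1, p.2.2, fun m => rfl⟩
  | zero => exact ⟨0, 0, by simp, by simp, fun m => by simp⟩
  | add φ ψ _ _ h₁ h₂ =>
    obtain ⟨ξ, η, hξ, hη, h⟩ := h₁
    obtain ⟨ξ', η', hξ', hη', h'⟩ := h₂
    -- Interleaving the two pairs of sequences merges the sum of two functionals into one.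
    let e : ℕ ≃ ℕ ⊕ ℕ := (Denumerable.eqv (ℕ ⊕ ℕ)).symm
    have key : ∀ x x' : ℕ → H, (Summable fun n => ‖x n‖ ^ 2) → (Summable fun n => ‖x' n‖ ^ 2) →
        Summable fun n => ‖Sum.elim x x' (e n)‖ ^ 2 := by
      intro x x' hx hx'
      refine (e.summable_iff (f := fun i => ‖Sum.elim x x' i‖ ^ 2)).2 ?_
      exact Summable.sum _ hx hx'
    refine ⟨fun n => Sum.elim ξ ξ' (e n), fun n => Sum.elim η η' (e n), key _ _ hξ hξ',
      key _ _ hη hη', fun m => ?_⟩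
    rw [e.tsum_eq fun i => ⟪Sum.elim η η' i, m.1 (Sum.elim ξ ξ' i)⟫_ℂ,
      LinearMap.add_apply, h, h']
    exact (HasSum.sum (f := fun i => ⟪Sum.elim η η' i, m.1 (Sum.elim ξ ξ' i)⟫_ℂ)
      (summable_inner_apply m.1 hξ hη).hasSum
      (summable_inner_apply m.1 hξ' hη').hasSum).tsum_eq.symm
  | smul r φ _ h₁ =>
    obtain ⟨ξ, η, hξ, hη, h⟩ := h₁
    refine ⟨fun n => r • ξ n, η, ?_, hη, fun m => ?_⟩
    · simpa [norm_smul, mul_pow] using hξ.mul_left (‖r‖ ^ 2)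
    · rw [LinearMap.smul_apply, h, smul_eq_mul, ← tsum_mul_left]
      exact tsum_congr fun n => by simp

/-- The Hilbert space `ℓ²`, in any universe. -/
abbrev Ell2 : Type u := lp (fun _ : ULift.{u} ℕ => ℂ) 2

/-- The standard basis of `ℓ²`. -/
def ell2Basis : HilbertBasis (ULift.{u} ℕ) ℂ Ell2.{u} := HilbertBasis.ofRepr (LinearIsometryEquiv.refl ℂ _)

/-- An ultraweakly continuous functional on `M ⊆ B(H)` is a vector functional of `H ⊗ ℓ²`. -/
theorem exists_inner_of_continuous {M : VonNeumannAlgebra H} (φ : M.toStarSubalgebra →ₗ[ℂ] ℂ)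
    (hφ : @Continuous _ _ (weakStar M) _ φ) :
    ∃ ξ η : HilbertTensor H Ell2.{u}, ∀ m, φ m = ⟪η, opTensor m.1 1 ξ⟫_ℂ := by
  obtain ⟨ξ, η, hξ, hη, h⟩ := exists_seq_of_continuous φ hφ
  have key : ∀ x : ℕ → H, (Summable fun n => ‖x n‖ ^ 2) →
      Summable fun n : ULift.{u} ℕ => ‖x n.down‖ ^ 2 := fun x hx =>
    (Equiv.ulift.summable_iff (f := fun n => ‖x n‖ ^ 2)).2 hx
  obtain ⟨ξ', hξ'⟩ := exists_adjoint_tmulRight_eq ell2Basis _ (key ξ hξ)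
  obtain ⟨η', hη'⟩ := exists_adjoint_tmulRight_eq ell2Basis _ (key η hη)
  refine ⟨ξ', η', fun m => ?_⟩
  rw [h, ← (hasSum_inner_adjoint_tmulRight ell2Basis η' _).tsum_eq]
  simp only [adjoint_tmulRight_opTensor, hξ', hη']
  exact (Equiv.ulift.tsum_eq fun n => ⟪η n, m.1 (ξ n)⟫_ℂ).symm

end Ultraweak

/-! ### Invariant subspaces and the bicommutant -/

section Bicommutant

variable {H K : Type u}
  [NormedAddCommGroup H] [InnerProductSpace ℂ H] [CompleteSpace H]
  [NormedAddCommGroup K] [InnerProductSpace ℂ K] [CompleteSpace K]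

/-- The projection onto a subspace that is invariant under `T` and `T*` commutes with `T`. -/
theorem commute_starProjection (V : Submodule ℂ H) [V.HasOrthogonalProjection] {T : H →L[ℂ] H}
    (h : ∀ x ∈ V, T x ∈ V) (h' : ∀ x ∈ V, star T x ∈ V) : Commute V.starProjection T := by
  ext x
  simp only [mul_apply_eq_comp]
  obtain ⟨y, hy, z, hz, rfl⟩ := V.exists_add_mem_mem_orthogonal x
  have h1 : T z ∈ Vᗮ := by
    intro v hv
    rw [← ContinuousLinearMap.adjoint_inner_left, ← ContinuousLinearMap.star_eq_adjoint]
    exact hz _ (h' v hv)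
  have h2 : ∀ w ∈ Vᗮ, V.starProjection w = 0 := fun w hw =>
    V.starProjection_apply_eq_zero_iff.2 hw
  simp only [map_add, h2 _ h1, h2 _ hz, Submodule.starProjection_eq_self_iff.2 hy,
    Submodule.starProjection_eq_self_iff.2 (h y hy), add_zero]

theorem mem_generated_iff {s : Set (H →L[ℂ] H)} (hs : ∀ a ∈ s, star a ∈ s) {t : H →L[ℂ] H} :
    t ∈ generated s ↔ ∀ b, (∀ a ∈ s, Commute b a) → Commute b t := by
  have h1 : s ∪ star s = s := Set.union_eq_self_of_subset_right fun a ha => by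
    simpa using hs _ ha
  have h2 : t ∈ generated s ↔ t ∈ (s ∪ star s).centralizer.centralizer := by
    rw [← StarSubalgebra.coe_centralizer_centralizer ℂ]
    rfl
  rw [h2, h1]
  simp only [Set.mem_centralizer_iff, Commute, SemiconjBy]
  exact ⟨fun h b hb => h b fun a ha => (hb a ha).symm, fun h b hb => h b fun a ha => (hb a ha).symm⟩

theorem opTensor_mul_one_apply (a b : H →L[ℂ] H) (ξ : HilbertTensor H K) :
    opTensor (a * b) 1 ξ = opTensor a (1 : K →L[ℂ] K) (opTensor b 1 ξ) := by
  rw [← mul_apply_eq_comp, opTensor_mul, one_mul]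

/-- The vector `(t ⊗ 1) ξ` is a limit of linear combinations of the vectors `(a ⊗ 1) ξ`, `a ∈ s`,
if `t` lies in the bicommutant of a `*`-closed monoid `s` of operators. -/
theorem opTensor_apply_mem_closure {s : Set (H →L[ℂ] H)} (hs : ∀ a ∈ s, star a ∈ s)
    (hone : 1 ∈ s) (hmul : ∀ a ∈ s, ∀ b ∈ s, a * b ∈ s) (ξ : HilbertTensor H K)
    {t : H →L[ℂ] H} (ht : t ∈ generated s) :
    opTensor t 1 ξ ∈ (Submodule.span ℂ {x | ∃ a ∈ s, x = opTensor a 1 ξ}).topologicalClosure := by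
  generalize hV : (Submodule.span ℂ {x | ∃ a ∈ s, x = opTensor a 1 ξ}).topologicalClosure = V
  have hVc : IsClosed (V : Set (HilbertTensor H K)) :=
    hV ▸ Submodule.isClosed_topologicalClosure _
  have hsub : ∀ a ∈ s, opTensor a 1 ξ ∈ V := fun a ha =>
    hV ▸ Submodule.le_topologicalClosure _ (Submodule.subset_span ⟨a, ha, rfl⟩)
  have : CompleteSpace V := hVc.completeSpace_coe
  have hinv : ∀ a ∈ s, ∀ x ∈ V, opTensor a 1 x ∈ V := by
    intro a ha
    have h1 : V ≤ V.comap (opTensor a 1).toLinearMap := by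
      conv_lhs => rw [← hV]
      refine Submodule.topologicalClosure_minimal _ (Submodule.span_le.2 ?_)
        (hVc.preimage (opTensor a 1).continuous)
      rintro _ ⟨b, hb, rfl⟩
      have h2 := hsub _ (hmul a ha b hb)
      rw [opTensor_mul_one_apply] at h2
      exact Submodule.mem_comap.2 h2
    exact fun x hx => h1 hx
  have hcomm : ∀ a ∈ s, Commute V.starProjection (opTensor a 1) := fun a ha =>
    commute_starProjection V (hinv a ha) (by
      rw [star_opTensor, star_one]
      exact hinv _ (hs a ha))
  have hξ : ξ ∈ V := by
    have h1 := hsub 1 hone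
    rwa [opTensor_one, one_apply_eq_self] at h1
  obtain ⟨κ, ⟨c⟩⟩ := exists_basis K
  -- Von Neumann's amplification argument: the projection commutes with `s ⊗ 1`, so its blocks lie
  -- in the commutant of `s` and hence commute with `t`.
  have ht' : Commute V.starProjection (opTensor t (1 : K →L[ℂ] K)) := by
    refine commute_opTensor_of_slice c fun j j' => ?_
    exact (mem_generated_iff hs).1 ht _ fun a ha => commute_slice (hcomm a ha) _ _
  have h1 := congrArg (fun S => S ξ) ht'.eq
  simp only [mul_apply_eq_comp, Submodule.starProjection_eq_self_iff.2 hξ] at h1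
  exact Submodule.starProjection_eq_self_iff.1 h1

theorem inner_eq_zero_of_mem_closure_span {S : Set H} {η x : H} (h : ∀ y ∈ S, ⟪η, y⟫_ℂ = 0)
    (hx : x ∈ (Submodule.span ℂ S).topologicalClosure) : ⟪η, x⟫_ℂ = 0 := by
  have : (Submodule.span ℂ S).topologicalClosure ≤ (Submodule.span ℂ {η})ᗮ := by
    refine Submodule.topologicalClosure_minimal _ (Submodule.span_le.2 ?_)
      (Submodule.isClosed_orthogonal _)
    intro y hy
    rw [SetLike.mem_coe, Submodule.mem_orthogonal_singleton_iff_inner_right, h y hy]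
  exact Submodule.mem_orthogonal_singleton_iff_inner_right.1 (this hx)

/-- Ultraweak density of the span of a `*`-closed monoid of operators in its bicommutant. -/
theorem eq_zero_of_generated {s : Set (H →L[ℂ] H)} (hs : ∀ a ∈ s, star a ∈ s)
    (hone : 1 ∈ s) (hmul : ∀ a ∈ s, ∀ b ∈ s, a * b ∈ s)
    (φ : (generated s).toStarSubalgebra →ₗ[ℂ] ℂ)
    (hφ : @Continuous _ _ (weakStar (generated s)) _ φ)
    (h : ∀ (a : H →L[ℂ] H) (ha : a ∈ s), φ ⟨a, subset_generated s ha⟩ = 0) : φ = 0 := by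
  -- On `H ⊗ ℓ²` a normal functional is a single vector functional, so vanishing on `s` means that
  -- `η` is orthogonal to `(s ⊗ 1) ξ`, and then to its closed span.
  obtain ⟨ξ, η, hφ⟩ := exists_inner_of_continuous φ hφ
  ext t
  rw [hφ, LinearMap.zero_apply]
  refine inner_eq_zero_of_mem_closure_span ?_ (opTensor_apply_mem_closure hs hone hmul ξ t.2)
  rintro _ ⟨a, ha, rfl⟩
  rw [← h a ha, hφ]

end Bicommutant

/-! ### Small ultraweakly dense sets -/

section Dense

open Filter Topology

variable {H : Type u} [NormedAddCommGroup H] [InnerProductSpace ℂ H] [CompleteSpace H]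

/-- A bounded net of functionals that converges on a Hilbert basis converges pointwise. -/
theorem tendsto_apply_of_hilbertBasis {ι α : Type*} {l : Filter α} (b : HilbertBasis ι ℂ H)
    {φ : α → H →L[ℂ] ℂ} {φ₀ : H →L[ℂ] ℂ} {C : ℝ} (hC : ∀ a, ‖φ a‖ ≤ C)
    (h : ∀ i, Tendsto (fun a => φ a (b i)) l (𝓝 (φ₀ (b i)))) (x : H) :
    Tendsto (fun a => φ a x) l (𝓝 (φ₀ x)) := by
  -- The uniform norm bound gives equicontinuity, which makes the set of points of convergence
  -- closed.
  have hequi : Equicontinuous fun a => (φ a : H → ℂ) := by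
    refine (LipschitzWith.uniformEquicontinuous (fun a => (φ a : H → ℂ)) C.toNNReal
      fun a => ?_).equicontinuous
    refine (φ a).lipschitz.weaken ?_
    rw [← NNReal.coe_le_coe]
    exact (hC a).trans (Real.le_coe_toNNReal C)
  let S : Submodule ℂ H :=
    { carrier := {x | Tendsto (fun a => φ a x) l (𝓝 (φ₀ x))}
      zero_mem' := by simpa using tendsto_const_nhds
      add_mem' := fun {x y} hx hy => by
        simp only [Set.mem_ofPred_eq, map_add] at *
        exact hx.add hy
      smul_mem' := fun r x hx => by
        simp only [Set.mem_ofPred_eq, map_smul] at *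
        exact hx.const_smul r }
  have hS : IsClosed (S : Set H) := hequi.isClosed_setOfPred_tendsto φ₀.continuous
  have : (⊤ : Submodule ℂ H) ≤ S := by
    rw [← b.dense_span]
    refine Submodule.topologicalClosure_minimal _ (Submodule.span_le.2 ?_) hS
    rintro _ ⟨i, rfl⟩
    exact h i
  exact this (Submodule.mem_top (x := x))

/-- A bounded net of operators whose matrix entries converge is ultraweakly convergent. -/
theorem tendsto_ultraweak {ι α : Type*} {l : Filter α} (b : HilbertBasis ι ℂ H)
    {T : α → H →L[ℂ] H} {T₀ : H →L[ℂ] H} {C : ℝ} (hC : ∀ a, ‖T a‖ ≤ C)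
    (h : ∀ i j, Tendsto (fun a => ⟪b i, T a (b j)⟫_ℂ) l (𝓝 ⟪b i, T₀ (b j)⟫_ℂ)) :
    Tendsto T l (@nhds _ (ultraweak H) T₀) := by
  -- Basis vectors are replaced by arbitrary vectors one slot at a time; conjugation makes the first
  -- slot linear.
  have h1 : ∀ j y, Tendsto (fun a => ⟪y, T a (b j)⟫_ℂ) l (𝓝 ⟪y, T₀ (b j)⟫_ℂ) := by
    intro j y
    have hb : ∀ a, ‖innerSL ℂ (T a (b j))‖ ≤ C := fun a => by
      rw [innerSL_apply_norm]
      refine ((T a).le_opNorm _).trans ?_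
      rw [b.orthonormal.1 j, mul_one]
      exact hC a
    have h2 := tendsto_apply_of_hilbertBasis (φ₀ := innerSL ℂ (T₀ (b j))) b hb (fun i => by
      simp only [innerSL_apply_apply]
      have := (Complex.continuous_conj.tendsto _).comp (h i j)
      simpa only [Function.comp_def, inner_conj_symm] using this) y
    have := (Complex.continuous_conj.tendsto _).comp h2
    simpa only [Function.comp_def, innerSL_apply_apply, inner_conj_symm] using this
  have h2 : ∀ x y, Tendsto (fun a => ⟪y, T a x⟫_ℂ) l (𝓝 ⟪y, T₀ x⟫_ℂ) := by
    intro x y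
    have hb : ∀ a, ‖innerSL ℂ y ∘L T a‖ ≤ ‖y‖ * C := fun a => by
      refine (ContinuousLinearMap.opNorm_comp_le _ _).trans ?_
      rw [innerSL_apply_norm]
      exact mul_le_mul_of_nonneg_left (hC a) (norm_nonneg _)
    exact tendsto_apply_of_hilbertBasis (φ₀ := innerSL ℂ y ∘L T₀) b hb (fun i => h1 i y) x
  simp only [nhds_iInf, nhds_induced, tendsto_iInf, tendsto_comap_iff]
  intro ξ η hξ hη
  refine tendsto_tsum_of_dominated_convergence ((hξ.add hη).mul_left C)
    (fun n => h2 (ξ n) (η n)) (Eventually.of_forall fun a n => ?_)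
  refine (norm_inner_apply_le (T a) _ _).trans ?_
  gcongr
  exact hC a

theorem exists_rat_approx (z : ℂ) (k : ℕ) :
    ∃ p : ℚ × ℚ, ‖z - ((p.1 : ℂ) + (p.2 : ℂ) * Complex.I)‖ ≤ 1 / ((k : ℝ) + 1) := by
  have hk : (0 : ℝ) < 1 / ((k : ℝ) + 1) / 2 := by positivity
  obtain ⟨p, hp1, hp2⟩ := exists_rat_btwn (lt_add_of_pos_right z.re hk)
  obtain ⟨q, hq1, hq2⟩ := exists_rat_btwn (lt_add_of_pos_right z.im hk)
  refine ⟨(p, q), (Complex.norm_le_abs_re_add_abs_im _).trans ?_⟩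
  have h1 : (z - ((p : ℂ) + (q : ℂ) * Complex.I)).re = z.re - p := by simp
  have h2 : (z - ((p : ℂ) + (q : ℂ) * Complex.I)).im = z.im - q := by simp
  simp only
  rw [h1, h2, abs_sub_comm, abs_sub_comm z.im, abs_of_pos (by linarith), abs_of_pos (by linarith)]
  linarith

/-- A von Neumann algebra on `H` has a `*`-closed ultraweakly dense subset of cardinality at most
`ℵ₀ * dim H`. -/
theorem exists_dense_set (M : VonNeumannAlgebra H) {ι : Type u} [Nonempty ι]
    (b : HilbertBasis ι ℂ H) :
    ∃ D : Set M.toStarSubalgebra, (∀ d ∈ D, star d ∈ D) ∧ #D ≤ ℵ₀ * #ι ∧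
      @Dense _ (weakStar M) D := by
  classical
  -- A code prescribes a norm bound, a precision, and rational approximations to finitely many
  -- matrix entries. The dense set contains one operator for each satisfiable code.
  let C := ℕ × ℕ × List ((ι × ι) × (ℚ × ℚ))
  let P : C → M.toStarSubalgebra → Prop := fun c m => ‖m.1‖ ≤ c.1 ∧ ∀ r ∈ c.2.2,
    ‖⟪b r.1.1, m.1 (b r.1.2)⟫_ℂ - ((r.2.1 : ℂ) + (r.2.2 : ℂ) * Complex.I)‖ ≤ 1 / ((c.2.1 : ℝ) + 1)
  have hex : ∀ c, ∃ d, (∃ m, P c m) → P c d := fun c => by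
    by_cases h : ∃ m, P c m
    · exact ⟨h.choose, fun _ => h.choose_spec⟩
    -- Unsatisfiable codes get the harmless default `0`.
    · exact ⟨0, fun h' => absurd h' h⟩
  choose d hd using hex
  let D : Set M.toStarSubalgebra := Set.range (Sum.elim d fun c => star (d c))
  refine ⟨D, ?_, ?_, ?_⟩
  · rintro _ ⟨c | c, rfl⟩
    · exact ⟨.inr c, rfl⟩
    · exact ⟨.inl c, by simp⟩
  · have h0 : ℵ₀ ≤ ℵ₀ * #ι := by
      have : 1 ≤ #ι := Cardinal.one_le_iff_ne_zero.2 (Cardinal.mk_ne_zero ι)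
      simpa using mul_le_mul_right this ℵ₀
    have h1 : #ι ≤ ℵ₀ * #ι := by
      simpa using mul_le_mul_left (Cardinal.one_le_aleph0) #ι
    have hlist : #(List ((ι × ι) × (ℚ × ℚ))) ≤ ℵ₀ * #ι := by
      refine (Cardinal.mk_list_le_max _).trans (max_le h0 ?_)
      simp only [Cardinal.mk_prod, Cardinal.lift_id, Cardinal.lift_uzero, Cardinal.mk_eq_aleph0,
        Cardinal.lift_aleph0]
      exact Cardinal.mul_le_of_le h0 (Cardinal.mul_le_of_le h0 h1 h1) h0
    have hC : #C ≤ ℵ₀ * #ι := by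
      simp only [C, Cardinal.mk_prod, Cardinal.mk_eq_aleph0,
        Cardinal.lift_aleph0, Cardinal.lift_uzero]
      exact Cardinal.mul_le_of_le h0 h0 (Cardinal.mul_le_of_le h0 h0 hlist)
    refine Cardinal.mk_range_le.trans ?_
    rw [Cardinal.mk_sum, Cardinal.lift_id]
    exact Cardinal.add_le_of_le h0 hC hC
  · intro m
    obtain ⟨n, hn⟩ := exists_nat_ge ‖m.1‖
    choose r hr using fun (p : ι × ι) (k : ℕ) => exists_rat_approx ⟪b p.1, m.1 (b p.2)⟫_ℂ k
    -- The net approximating `m` is indexed by a finite set of entries and a precision; the norm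
    -- bound `n` stays fixed, so the net is bounded. Its codes are satisfiable because `m` satisfies
    -- them.
    let c : Finset (ι × ι) × ℕ → C := fun a => (n, a.2, a.1.toList.map fun p => (p, r p a.2))
    have hP : ∀ a, P (c a) (d (c a)) := fun a => hd _ ⟨m, hn, fun q hq => by
      obtain ⟨p, -, rfl⟩ := List.mem_map.1 hq
      exact hr p a.2⟩
    -- The factor 2 comes from comparing both entries with the same rational point.
    have happrox : ∀ (a : Finset (ι × ι) × ℕ), ∀ p ∈ a.1,
        ‖⟪b p.1, (d (c a)).1 (b p.2)⟫_ℂ - ⟪b p.1, m.1 (b p.2)⟫_ℂ‖ ≤ 2 * (1 / ((a.2 : ℝ) + 1)) := by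
      intro a p hp
      have h1 := (hP a).2 (p, r p a.2) (List.mem_map.2 ⟨p, by simpa using hp, rfl⟩)
      have h2 := hr p a.2
      rw [norm_sub_rev] at h2
      refine (norm_sub_le_norm_sub_add_norm_sub _
        (((r p a.2).1 : ℂ) + ((r p a.2).2 : ℂ) * Complex.I) _).trans ?_
      have h3 : (c a).2.1 = a.2 := rfl
      simp only [h3] at h1
      linarith
    have htend : Tendsto (fun a => (d (c a)).1) atTop (@nhds _ (ultraweak H) m.1) := by
      refine tendsto_ultraweak b (C := n) (fun a => (hP a).1) fun i j => ?_
      rw [tendsto_iff_norm_sub_tendsto_zero]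
      have hlim : Tendsto (fun a : Finset (ι × ι) × ℕ => 2 * (1 / ((a.2 : ℝ) + 1))) atTop (𝓝 0) := by
        have h1 : Tendsto (fun a : Finset (ι × ι) × ℕ => a.2) atTop atTop := by
          rw [← prod_atTop_atTop_eq]
          exact tendsto_snd
        have h2 := (tendsto_one_div_add_atTop_nhds_zero_nat (𝕜 := ℝ)).comp h1
        simpa using h2.const_mul 2
      refine squeeze_zero' (Eventually.of_forall fun a => norm_nonneg _) ?_ hlim
      filter_upwards [eventually_ge_atTop (({(i, j)} : Finset (ι × ι)), 0)] with a ha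
      exact happrox a (i, j) (ha.1 (by simp))
    let _ := weakStar M
    refine mem_closure_of_tendsto (f := fun a => d (c a)) (b := atTop) ?_
      (Eventually.of_forall fun a => ⟨.inl (c a), rfl⟩)
    rw [@nhds_induced _ _ (ultraweak H) Subtype.val m, tendsto_comap_iff]
    exact htend

end Dense

/-! ### Intertwiners and cyclic vectors -/

section Intertwiner

variable {X Y : Type*}
  [NormedAddCommGroup X] [InnerProductSpace ℂ X] [CompleteSpace X]
  [NormedAddCommGroup Y] [InnerProductSpace ℂ Y] [CompleteSpace Y]

/-- If all unitaries in the commutant of a `*`-closed set `S` commute with `t`, then so does the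
whole commutant of `S`. -/
theorem commute_of_unitary {S : Set (X →L[ℂ] X)} (hS : ∀ a ∈ S, star a ∈ S) {t : X →L[ℂ] X}
    (h : ∀ u ∈ unitary (X →L[ℂ] X), (∀ a ∈ S, Commute u a) → Commute u t)
    {b : X →L[ℂ] X} (hb : ∀ a ∈ S, Commute b a) : Commute b t := by
  -- The commutant of `S` is norm closed, hence a C*-algebra, and a unital C*-algebra is spanned by
  -- its unitaries.
  let A := StarSubalgebra.centralizer ℂ S
  have hmem : ∀ x : X →L[ℂ] X, x ∈ A ↔ ∀ a ∈ S, Commute x a := fun x => by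
    rw [StarSubalgebra.mem_centralizer_iff]
    exact ⟨fun h a ha => (h a ha).1.symm, fun h a ha => ⟨(h a ha).symm, (h _ (hS a ha)).symm⟩⟩
  have hclosed : IsClosed (A : Set (X →L[ℂ] X)) := by
    rw [StarSubalgebra.coe_centralizer]
    exact Set.isClosed_centralizer _
  have : CompleteSpace A := hclosed.completeSpace_coe
  let _ : CStarAlgebra A := { }
  have key : ∀ x : A, Commute x.1 t := by
    intro x
    have hx : x ∈ Submodule.span ℂ (unitary A : Set A) := by
      rw [CStarAlgebra.span_unitary]
      exact Submodule.mem_top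
    induction hx using Submodule.span_induction with
    | mem u hu =>
      refine h u.1 ?_ ((hmem _).1 u.2)
      rw [SetLike.mem_coe, Unitary.mem_iff] at hu
      exact Unitary.mem_iff.2 ⟨congrArg Subtype.val hu.1, congrArg Subtype.val hu.2⟩
    | zero => exact Commute.zero_left t
    | add x y _ _ hx hy => exact hx.add_left hy
    | smul r x _ hx => exact hx.smul_left r
  exact key ⟨b, (hmem b).2 hb⟩

/-- Extension of a densely defined bounded map, by zero on the orthogonal complement. The extension
intertwines all operators that the given map intertwines. -/
theorem exists_intertwiner {G : Type*} [AddCommGroup G] [Module ℂ G] (e : G →ₗ[ℂ] X)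
    (f : G →ₗ[ℂ] Y) {C : ℝ} (h : ∀ g, ‖f g‖ ≤ C * ‖e g‖) :
    ∃ u : X →L[ℂ] Y, (∀ g, u (e g) = f g) ∧
      ∀ (S : X →L[ℂ] X) (S' : Y →L[ℂ] Y), (∀ g, ∃ g', e g' = S (e g) ∧ f g' = S' (f g)) →
        (∀ g, ∃ g', e g' = star S (e g)) → u ∘L S = S' ∘L u := by
  set V := (LinearMap.range e).topologicalClosure with hV
  have hVc : IsClosed (V : Set X) := Submodule.isClosed_topologicalClosure _
  have hVs : CompleteSpace V := hVc.completeSpace_coe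
  have heV : ∀ g, e g ∈ V := fun g => Submodule.le_topologicalClosure _ ⟨g, rfl⟩
  let e' : G →ₗ[ℂ] V := e.codRestrict V heV
  have hdense : DenseRange e' := by
    intro x
    rw [Topology.IsInducing.subtypeVal.closure_eq_preimage_closure_image]
    have h1 : Subtype.val '' Set.range e' = Set.range e := by
      rw [← Set.range_comp]
      rfl
    exact (Set.ext_iff.1 (congrArg closure h1) x.1).2 x.2
  have hnorm : ∀ g, ‖f g‖ ≤ C * ‖e' g‖ := h
  let u : X →L[ℂ] Y := (f.extendOfNorm e') ∘L V.orthogonalProjectionOnto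
  have hu : ∀ g, u (e g) = f g := by
    intro g
    have h1 : V.orthogonalProjectionOnto (e g) = e' g :=
      V.orthogonalProjectionOnto_mem_subspace_eq_self (e' g)
    change f.extendOfNorm e' (V.orthogonalProjectionOnto (e g)) = f g
    rw [h1]
    exact LinearMap.extendOfNorm_eq hdense ⟨C, hnorm⟩ g
  have hu0 : ∀ x ∈ Vᗮ, u x = 0 := by
    intro x hx
    change f.extendOfNorm e' (V.orthogonalProjectionOnto x) = 0
    rw [V.orthogonalProjectionOnto_eq_zero_iff.2 hx, map_zero]
  refine ⟨u, hu, fun S S' hS hS' => ?_⟩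
  have h1 : V ≤ (u ∘L S - S' ∘L u).ker := by
    refine Submodule.topologicalClosure_minimal _ ?_ (u ∘L S - S' ∘L u).isClosed_ker
    rintro _ ⟨g, rfl⟩
    obtain ⟨g', h1, h2⟩ := hS g
    simp only [LinearMap.mem_ker, ContinuousLinearMap.coe_coe, sub_apply,
      ContinuousLinearMap.comp_apply, hu]
    rw [← h1, hu, h2, sub_self]
  -- Since `star S` preserves the range of `e`, `S` preserves its orthogonal complement, where both
  -- sides of the intertwining relation vanish.
  have h2 : ∀ x ∈ Vᗮ, S x ∈ Vᗮ := by
    intro x hx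
    rw [hV, Submodule.orthogonal_closure] at hx ⊢
    rintro _ ⟨g, rfl⟩
    obtain ⟨g', h1⟩ := hS' g
    rw [← ContinuousLinearMap.adjoint_inner_left, ← ContinuousLinearMap.star_eq_adjoint, ← h1]
    exact hx _ ⟨g', rfl⟩
  ext x
  obtain ⟨y, hy, z, hz, rfl⟩ := V.exists_add_mem_mem_orthogonal x
  have h3 := h1 hy
  simp only [LinearMap.mem_ker, ContinuousLinearMap.coe_coe, sub_apply,
    ContinuousLinearMap.comp_apply, sub_eq_zero] at h3
  simp only [ContinuousLinearMap.comp_apply, map_add, hu0 z hz, hu0 _ (h2 z hz), h3, map_zero]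

variable {σ : Type*}

/-- The product of a word in the operators `T s`. -/
def word (T : σ → X →L[ℂ] X) (w : List σ) : X →L[ℂ] X := (w.map T).prod

theorem word_nil (T : σ → X →L[ℂ] X) : word T [] = 1 := rfl

theorem word_cons (T : σ → X →L[ℂ] X) (s : σ) (w : List σ) :
    word T (s :: w) = T s * word T w := rfl

theorem word_append (T : σ → X →L[ℂ] X) (v w : List σ) :
    word T (v ++ w) = word T v * word T w := by
  simp [word]

theorem star_word {T : σ → X →L[ℂ] X} {inv : σ → σ} (hT : ∀ s, T (inv s) = star (T s))
    (w : List σ) : star (word T w) = word T (w.map inv).reverse := by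
  induction w with
  | nil => simp [word_nil]
  | cons s w ih => rw [word_cons, star_mul, ih, List.map_cons, List.reverse_cons, word_append,
      word_cons, word_nil, mul_one, hT]

/-- Linear combinations of the vectors `w x`, for words `w`. -/
def wordSum (T : σ → X →L[ℂ] X) (x : X) : (List σ →₀ ℂ) →ₗ[ℂ] X :=
  Finsupp.linearCombination ℂ fun w => word T w x

theorem wordSum_single (T : σ → X →L[ℂ] X) (x : X) (w : List σ) :
    wordSum T x (Finsupp.single w 1) = word T w x := by
  simp [wordSum]

theorem wordSum_mapDomain (T : σ → X →L[ℂ] X) (x : X) (s : σ) (g : List σ →₀ ℂ) :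
    wordSum T x (Finsupp.mapDomain (s :: ·) g) = T s (wordSum T x g) := by
  simp only [wordSum, Finsupp.linearCombination_mapDomain]
  rw [← ContinuousLinearMap.coe_coe (T s), ← LinearMap.comp_apply, LinearMap.comp_apply,
    Finsupp.apply_linearCombination]
  rfl

theorem range_wordSum (T : σ → X →L[ℂ] X) (x : X) :
    LinearMap.range (wordSum T x) = Submodule.span ℂ (Set.range fun w => word T w x) :=
  Finsupp.range_linearCombination _

/-- The moments of a vector `x` with respect to the operators `T s`. -/
def moment (T : σ → X →L[ℂ] X) (x : X) (w : List σ) : ℂ := ⟪x, word T w x⟫_ℂ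

/-- The inner product of `v x` and `w x` is the moment of the word `v* w`, so moments determine the
Gram matrix of the orbit of `x`. This is the uniqueness half of the GNS construction. -/
theorem norm_wordSum_eq {T : σ → X →L[ℂ] X} {T' : σ → Y →L[ℂ] Y} {inv : σ → σ}
    (hT : ∀ s, T (inv s) = star (T s)) (hT' : ∀ s, T' (inv s) = star (T' s)) {x : X} {y : Y}
    (h : moment T x = moment T' y) (g : List σ →₀ ℂ) : ‖wordSum T x g‖ = ‖wordSum T' y g‖ := by
  have hw : ∀ v w, ⟪word T v x, word T w x⟫_ℂ = ⟪word T' v y, word T' w y⟫_ℂ := by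
    intro v w
    rw [← ContinuousLinearMap.adjoint_inner_right, ← ContinuousLinearMap.adjoint_inner_right,
      ← ContinuousLinearMap.star_eq_adjoint, ← ContinuousLinearMap.star_eq_adjoint,
      star_word hT, star_word hT', ← mul_apply_eq_comp, ← mul_apply_eq_comp, ← word_append,
      ← word_append]
    exact congrFun h _
  have hi : ⟪wordSum T x g, wordSum T x g⟫_ℂ = ⟪wordSum T' y g, wordSum T' y g⟫_ℂ := by
    simp only [wordSum, Finsupp.linearCombination_apply, Finsupp.sum]
    simp only [sum_inner, inner_sum, inner_smul_left, inner_smul_right, hw]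
  rw [@norm_eq_sqrt_re_inner ℂ, @norm_eq_sqrt_re_inner ℂ, hi]

/-- Two vectors with the same moments are related by an intertwiner. -/
theorem exists_intertwiner_of_moment {T : σ → X →L[ℂ] X} {T' : σ → Y →L[ℂ] Y} {inv : σ → σ}
    (hT : ∀ s, T (inv s) = star (T s)) (hT' : ∀ s, T' (inv s) = star (T' s)) {x : X} {y : Y}
    (h : moment T x = moment T' y) :
    ∃ u : X →L[ℂ] Y, u x = y ∧ ∀ s, u ∘L T s = T' s ∘L u := by
  obtain ⟨u, hu, hint⟩ := exists_intertwiner (wordSum T x) (wordSum T' y) (C := 1)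
    fun g => by rw [one_mul, norm_wordSum_eq hT hT' h]
  refine ⟨u, ?_, fun s => hint _ _ (fun g => ⟨Finsupp.mapDomain (s :: ·) g, ?_, ?_⟩) fun g =>
    ⟨Finsupp.mapDomain (inv s :: ·) g, ?_⟩⟩
  · simpa [wordSum_single, word_nil] using hu (Finsupp.single [] 1)
  · rw [wordSum_mapDomain]
  · rw [wordSum_mapDomain]
  · rw [wordSum_mapDomain, hT]

/-- Two cyclic vectors with the same moments are related by a unitary intertwiner. -/
theorem exists_unitary_of_moment {T : σ → X →L[ℂ] X} {T' : σ → Y →L[ℂ] Y} {inv : σ → σ}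
    (hT : ∀ s, T (inv s) = star (T s)) (hT' : ∀ s, T' (inv s) = star (T' s)) {x : X} {y : Y}
    (h : moment T x = moment T' y)
    (hx : (Submodule.span ℂ (Set.range fun w => word T w x)).topologicalClosure = ⊤)
    (hy : (Submodule.span ℂ (Set.range fun w => word T' w y)).topologicalClosure = ⊤) :
    ∃ U : X ≃ₗᵢ[ℂ] Y, ∀ s z, U (T s z) = T' s (U z) := by
  have hx' : DenseRange (wordSum T x) := by
    rw [← range_wordSum, ← Submodule.dense_iff_topologicalClosure_eq_top] at hx
    exact hx
  have hy' : DenseRange (wordSum T' y) := by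
    rw [← range_wordSum, ← Submodule.dense_iff_topologicalClosure_eq_top] at hy
    exact hy
  let U : X ≃ₗᵢ[ℂ] Y := (LinearEquiv.refl ℂ (List σ →₀ ℂ)).extendOfIsometry (wordSum T x)
    (wordSum T' y) hx' hy' fun g => (norm_wordSum_eq hT hT' h g).symm
  have hU : ∀ g, U (wordSum T x g) = wordSum T' y g := fun g =>
    LinearEquiv.extendOfIsometry_eq ..
  refine ⟨U, fun s z => ?_⟩
  refine hx'.induction_on z (isClosed_eq (by fun_prop) (by fun_prop)) fun g => ?_
  rw [← wordSum_mapDomain, hU, hU, wordSum_mapDomain]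

end Intertwiner

/-! ### Cardinality estimates -/

section Cardinality

/-- A Hilbert space with a topologically generating family of `κ` vectors has dimension at most
`κ`. -/
theorem hilbertDim_le {X : Type u} [NormedAddCommGroup X] [InnerProductSpace ℂ X] [CompleteSpace X]
    {W : Type u} (a : W → X) (ha : (Submodule.span ℂ (Set.range a)).topologicalClosure = ⊤)
    {κ : Cardinal.{u}} (hκ : ℵ₀ ≤ κ) (hW : #W ≤ κ) : hilbertDim X ≤ κ := by
  obtain ⟨ι, ⟨b⟩⟩ := exists_basis X
  rw [← mk_eq_hilbertDim b]
  -- Each generator has countably many nonzero coordinates, and a basis vector orthogonal to all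
  -- generators would be zero.
  have hcount : ∀ w, {i : ι | ⟪a w, b i⟫_ℂ ≠ 0}.Countable := fun w => by
    have h := (b.summable_inner_mul_inner (a w) (a w)).countable_support
    refine h.mono fun j hj => ?_
    simp only [Function.mem_support, ne_eq, mul_eq_zero, not_or]
    exact ⟨hj, fun h0 => hj (inner_eq_zero_symm.1 h0)⟩
  have hcover : (Set.univ : Set ι) ⊆ ⋃ w, {i : ι | ⟪a w, b i⟫_ℂ ≠ 0} := by
    intro i _
    by_contra hi
    simp only [Set.mem_iUnion, Set.mem_ofPred_eq, not_exists, not_not] at hi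
    have h0 : ⟪b i, b i⟫_ℂ = 0 := by
      refine inner_eq_zero_of_mem_closure_span (S := Set.range a) ?_ (by rw [ha]; trivial)
      rintro _ ⟨w, rfl⟩
      exact inner_eq_zero_symm.1 (hi w)
    have h1 := b.orthonormal.1 i
    rw [inner_self_eq_zero.1 h0] at h1
    simp at h1
  calc #ι = #(Set.univ : Set ι) := Cardinal.mk_univ.symm
    _ ≤ #(⋃ w, {i : ι | ⟪a w, b i⟫_ℂ ≠ 0} : Set ι) := Cardinal.mk_le_mk_of_subset hcover
    _ ≤ #W * ⨆ w, #({i : ι | ⟪a w, b i⟫_ℂ ≠ 0} : Set ι) := Cardinal.mk_iUnion_le _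
    _ ≤ κ * ℵ₀ := by
        gcongr
        exact ciSup_le' fun w => (hcount w).le_aleph0
    _ = κ := Cardinal.mul_aleph0_eq hκ

theorem mk_list_le {σ : Type u} {κ : Cardinal.{u}} (hκ : ℵ₀ ≤ κ) (hσ : #σ ≤ κ) :
    #(List σ) ≤ κ :=
  (Cardinal.mk_list_le_max σ).trans (max_le hκ hσ)

/-- There are at most `κ` words, and `𝔠 ^ κ = 2 ^ (ℵ₀ * κ) = 2 ^ κ` for infinite `κ`. This bounds
the number of moment functionals. -/
theorem mk_word_functional_le {σ : Type u} {κ : Cardinal.{u}} (hκ : ℵ₀ ≤ κ) (hσ : #σ ≤ κ) :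
    #(List σ → ℂ) ≤ 2 ^ κ := by
  rw [Cardinal.mk_pi, Cardinal.prod_const, Cardinal.mk_complex, Cardinal.lift_continuum,
    Cardinal.lift_uzero, ← Cardinal.two_power_aleph0, ← Cardinal.power_mul]
  exact Cardinal.power_le_power_left two_ne_zero
    (Cardinal.mul_le_of_le hκ hκ (mk_list_le hκ hσ))

end Cardinality

/-! ### Constructions of morphisms -/

section Morphisms

variable {H K L X Y : Type u}
  [NormedAddCommGroup H] [InnerProductSpace ℂ H] [CompleteSpace H]
  [NormedAddCommGroup K] [InnerProductSpace ℂ K] [CompleteSpace K]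
  [NormedAddCommGroup L] [InnerProductSpace ℂ L] [CompleteSpace L]
  [NormedAddCommGroup X] [InnerProductSpace ℂ X] [CompleteSpace X]
  [NormedAddCommGroup Y] [InnerProductSpace ℂ Y] [CompleteSpace Y]
  {M : VonNeumannAlgebra H} {N : VonNeumannAlgebra K} {R : VonNeumannAlgebra L}

theorem eq_of_continuous_of_dense {Z : Type*} {t : TopologicalSpace Z} {D : Set Z} (hD : Dense D)
    {f g : Z → ℂ} (hf : Continuous f) (hg : Continuous g) (h : ∀ d ∈ D, f d = g d) : f = g :=
  hf.ext_on hD hg h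

theorem continuous_sub_functional {Z : Type*} {t : TopologicalSpace Z} {f g : Z → ℂ}
    (hf : Continuous f) (hg : Continuous g) : Continuous fun z => f z - g z :=
  hf.sub hg

/-- A morphism from a normal `*`-homomorphism into `B(X)`. -/
def Morphism.ofStarAlgHom (f : M.toStarSubalgebra →⋆ₐ[ℂ] (X →L[ℂ] X)) (R : VonNeumannAlgebra X)
    (hR : ∀ m, f m ∈ R) (hf : @Continuous _ _ (weakStar M) (ultraweak X) f) : Morphism M R where
  hom := f.codRestrict R.toStarSubalgebra hR
  normal := by
    rw [continuous_induced_rng]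
    exact hf

theorem Morphism.continuous_coe (f : Morphism M N) :
    @Continuous _ _ (weakStar M) (ultraweak K) fun m => (f m).1 :=
  @Continuous.comp _ _ _ (weakStar M) (weakStar N) (ultraweak K) _ _
    (@continuous_induced_dom _ _ _ (ultraweak K)) f.normal

/-- Composition of morphisms. -/
def Morphism.comp (g : Morphism N R) (f : Morphism M N) : Morphism M R where
  hom := g.hom.comp f.hom
  normal := @Continuous.comp _ _ _ (weakStar M) (weakStar N) (weakStar R) _ _ g.normal f.normal

theorem Morphism.continuous_inner (f : Morphism M N) (x y : K) :
    @Continuous _ _ (weakStar M) _ fun m => ⟪y, (f m).1 x⟫_ℂ :=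
  @Continuous.comp _ _ _ (weakStar M) (ultraweak K) _ _ _
    (continuous_ultraweak_inner x y) f.continuous_coe

theorem Morphism.coe_star (f : Morphism M N) (m : M.toStarSubalgebra) :
    (f (star m)).1 = star (f m).1 :=
  congrArg Subtype.val (map_star f.hom m)

theorem Morphism.coe_mul (f : Morphism M N) (m m' : M.toStarSubalgebra) :
    (f (m * m')).1 = (f m).1 * (f m').1 :=
  congrArg Subtype.val (map_mul f.hom m m')

theorem Morphism.coe_one (f : Morphism M N) : (f 1).1 = 1 :=
  congrArg Subtype.val (map_one f.hom)

/-- The `*`-homomorphism `m ↦ B* m B`, for an isometry `B` whose range is `M`-invariant. -/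
def compress (M : VonNeumannAlgebra H) (B : X →L[ℂ] H)
    (h1 : ContinuousLinearMap.adjoint B ∘L B = 1)
    (h2 : ∀ m ∈ M, m ∘L B ∘L ContinuousLinearMap.adjoint B =
      B ∘L ContinuousLinearMap.adjoint B ∘L m) :
    M.toStarSubalgebra →⋆ₐ[ℂ] (X →L[ℂ] X) where
  toFun m := ContinuousLinearMap.adjoint B ∘L m.1 ∘L B
  map_one' := h1
  map_zero' := by
    ext x
    simp
  map_mul' m m' := by
    -- Multiplicativity rests on `m'` keeping the range of `B` invariant, as it commutes with `B
    -- B*`.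
    have h3 : ∀ x, m'.1 (B x) = B (ContinuousLinearMap.adjoint B (m'.1 (B x))) := fun x => by
      have := congrArg (fun S => S (B x)) (h2 m'.1 m'.2)
      simp only [ContinuousLinearMap.comp_apply] at this
      have h4 : ContinuousLinearMap.adjoint B (B x) = x := congrArg (fun S => S x) h1
      rw [← this, h4]
    ext x
    simp only [ContinuousLinearMap.comp_apply, mul_apply_eq_comp, MulMemClass.coe_mul]
    rw [← h3]
  map_add' m m' := by
    ext x
    simp
  commutes' r := by
    ext x
    have h4 : ContinuousLinearMap.adjoint B (B x) = x := congrArg (fun S => S x) h1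
    simp [Algebra.algebraMap_eq_smul_one, h4]
  map_star' m := by
    simp [ContinuousLinearMap.star_eq_adjoint, ContinuousLinearMap.adjoint_comp,
      ContinuousLinearMap.comp_assoc]

theorem continuous_compress (M : VonNeumannAlgebra H) (B : X →L[ℂ] H)
    (h1 : ContinuousLinearMap.adjoint B ∘L B = 1)
    (h2 : ∀ m ∈ M, m ∘L B ∘L ContinuousLinearMap.adjoint B =
      B ∘L ContinuousLinearMap.adjoint B ∘L m) :
    @Continuous _ _ (weakStar M) (ultraweak X) (compress M B h1 h2) :=
  @Continuous.comp _ _ _ (weakStar M) (ultraweak H) (ultraweak X) _ _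
    (continuous_ultraweak_conj (ContinuousLinearMap.adjoint B) B)
    (@continuous_induced_dom _ _ _ (ultraweak H))

/-- The morphism `m ↦ U m U*` given by a unitary operator `U : H → X`. -/
def conj (M : VonNeumannAlgebra H) (U : H ≃ₗᵢ[ℂ] X) (R : VonNeumannAlgebra X)
    (hR : ∀ m ∈ M, (U.toContinuousLinearEquiv : H →L[ℂ] X) ∘L m ∘L
      (U.symm.toContinuousLinearEquiv : X →L[ℂ] H) ∈ R) : Morphism M R :=
  have hU : ContinuousLinearMap.adjoint (U.symm.toContinuousLinearEquiv : X →L[ℂ] H) =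
      (U.toContinuousLinearEquiv : H →L[ℂ] X) :=
    LinearIsometryEquiv.adjoint_eq_symm U.symm
  have h1 : ContinuousLinearMap.adjoint (U.symm.toContinuousLinearEquiv : X →L[ℂ] H) ∘L
      (U.symm.toContinuousLinearEquiv : X →L[ℂ] H) = 1 := by
    rw [hU]
    ext x
    simp
  have h2 : ∀ m ∈ M, m ∘L (U.symm.toContinuousLinearEquiv : X →L[ℂ] H) ∘L
      ContinuousLinearMap.adjoint (U.symm.toContinuousLinearEquiv : X →L[ℂ] H) =
      (U.symm.toContinuousLinearEquiv : X →L[ℂ] H) ∘L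
        ContinuousLinearMap.adjoint (U.symm.toContinuousLinearEquiv : X →L[ℂ] H) ∘L m := by
    intro m _
    rw [hU]
    ext x
    simp
  Morphism.ofStarAlgHom (compress M _ h1 h2) R (fun m => by
    have := hR m.1 m.2
    rwa [← hU] at this) (continuous_compress M _ h1 h2)

theorem conj_apply (M : VonNeumannAlgebra H) (U : H ≃ₗᵢ[ℂ] X) (R : VonNeumannAlgebra X) (hR)
    (m : M.toStarSubalgebra) (x : X) : (conj M U R hR m).1 x = U (m.1 (U.symm x)) := by
  change ContinuousLinearMap.adjoint (U.symm.toContinuousLinearEquiv : X →L[ℂ] H) _ = _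
  rw [show ContinuousLinearMap.adjoint (U.symm.toContinuousLinearEquiv : X →L[ℂ] H) =
      (U.toContinuousLinearEquiv : H →L[ℂ] X) from LinearIsometryEquiv.adjoint_eq_symm U.symm]
  rfl

/-- The morphism `a ↦ a ⊗ 1`. -/
def tensorOne (H K : Type u) [NormedAddCommGroup H] [InnerProductSpace ℂ H] [CompleteSpace H]
    [NormedAddCommGroup K] [InnerProductSpace ℂ K] [CompleteSpace K] :
    Morphism (full H) (full (HilbertTensor H K)) :=
  Morphism.ofStarAlgHom
    { toFun := fun a => opTensor a.1 1
      map_one' := opTensor_one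
      map_zero' := opTensor_zero_left 1
      map_mul' := fun a a' => by
        rw [opTensor_mul, one_mul]
        rfl
      map_add' := fun a a' => opTensor_add_left a.1 a'.1 1
      commutes' := fun r => by
        rw [Algebra.algebraMap_eq_smul_one, Algebra.algebraMap_eq_smul_one, ← opTensor_one,
          ← opTensor_smul_left]
        rfl
      map_star' := fun a => by
        rw [star_opTensor, star_one]
        rfl } _ (fun _ => trivial)
    (@Continuous.comp _ _ _ (weakStar (full H)) (ultraweak H) (ultraweak (HilbertTensor H K)) _ _
      continuous_ultraweak_opTensor (@continuous_induced_dom _ _ _ (ultraweak H)))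

/-- The morphism `b ↦ 1 ⊗ b`. -/
def oneTensor (H K : Type u) [NormedAddCommGroup H] [InnerProductSpace ℂ H] [CompleteSpace H]
    [NormedAddCommGroup K] [InnerProductSpace ℂ K] [CompleteSpace K] :
    Morphism (full K) (full (HilbertTensor H K)) :=
  Morphism.ofStarAlgHom
    { toFun := fun a => opTensor 1 a.1
      map_one' := opTensor_one
      map_zero' := opTensor_zero_right 1
      map_mul' := fun a a' => by
        rw [opTensor_mul, one_mul]
        rfl
      map_add' := fun a a' => opTensor_add_right 1 a.1 a'.1
      commutes' := fun r => by
        rw [Algebra.algebraMap_eq_smul_one, Algebra.algebraMap_eq_smul_one, ← opTensor_one,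
          ← opTensor_smul_right]
        rfl
      map_star' := fun a => by
        rw [star_opTensor, star_one]
        rfl } _ (fun _ => trivial)
    (@Continuous.comp _ _ _ (weakStar (full K)) (ultraweak K) (ultraweak (HilbertTensor H K)) _ _
      continuous_ultraweak_opTensor_right (@continuous_induced_dom _ _ _ (ultraweak K)))

/-- An operator that intertwines two morphisms on an ultraweakly dense set intertwines them. -/
theorem intertwines_of_dense {D : Set M.toStarSubalgebra} (hD : @Dense _ (weakStar M) D)
    {f : Morphism M N} {g : Morphism M R} {u : K →L[ℂ] L}
    (h : ∀ d ∈ D, u ∘L (f d).1 = (g d).1 ∘L u) (m : M.toStarSubalgebra) :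
    u ∘L (f m).1 = (g m).1 ∘L u := by
  refine ContinuousLinearMap.ext fun x => ext_inner_left ℂ fun y => ?_
  have hf := f.continuous_inner x (ContinuousLinearMap.adjoint u y)
  have hg := g.continuous_inner (u x) y
  have := eq_of_continuous_of_dense hD hf hg fun d hd => by
    rw [ContinuousLinearMap.adjoint_inner_left, ← ContinuousLinearMap.comp_apply, h d hd]
    rfl
  have h2 := congrFun this m
  rw [ContinuousLinearMap.adjoint_inner_left] at h2
  exact h2

/-- An operator that intertwines two morphisms on a generating `*`-closed monoid intertwines
them. -/
theorem intertwines_of_generated {s : Set (H →L[ℂ] H)} (hs : ∀ a ∈ s, star a ∈ s)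
    (hone : 1 ∈ s) (hmul : ∀ a ∈ s, ∀ b ∈ s, a * b ∈ s)
    {f : Morphism (generated s) N} {g : Morphism (generated s) R} {u : K →L[ℂ] L}
    (h : ∀ a (ha : a ∈ s), u ∘L (f ⟨a, subset_generated s ha⟩).1 =
      (g ⟨a, subset_generated s ha⟩).1 ∘L u) (m : (generated s).toStarSubalgebra) :
    u ∘L (f m).1 = (g m).1 ∘L u := by
  refine ContinuousLinearMap.ext fun x => ext_inner_left ℂ fun y => ?_
  have hf := f.continuous_inner x (ContinuousLinearMap.adjoint u y)
  have hg := g.continuous_inner (u x) y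
  -- The defect of the intertwining relation between `x` and `y` is a normal functional, so it
  -- vanishes as soon as it does on `s`.
  let φ : (generated s).toStarSubalgebra →ₗ[ℂ] ℂ :=
    { toFun := fun m => ⟪ContinuousLinearMap.adjoint u y, (f m).1 x⟫_ℂ - ⟪y, (g m).1 (u x)⟫_ℂ
      map_add' := fun m m' => by
        have h1 : (f (m + m')).1 = (f m).1 + (f m').1 := congrArg Subtype.val (map_add f.hom m m')
        have h2 : (g (m + m')).1 = (g m).1 + (g m').1 := congrArg Subtype.val (map_add g.hom m m')
        rw [h1, h2]
        simp only [add_apply, inner_add_right]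
        ring
      map_smul' := fun r m => by
        have h1 : (f (r • m)).1 = r • (f m).1 := congrArg Subtype.val (map_smul f.hom r m)
        have h2 : (g (r • m)).1 = r • (g m).1 := congrArg Subtype.val (map_smul g.hom r m)
        rw [h1, h2]
        simp only [smul_apply, inner_smul_right, RingHom.id_apply, smul_eq_mul]
        ring }
  have hφ : @Continuous _ _ (weakStar (generated s)) _ φ :=
    continuous_sub_functional hf hg
  have h0 := eq_zero_of_generated hs hone hmul φ hφ fun a ha => by
    change ⟪ContinuousLinearMap.adjoint u y, _⟫_ℂ - _ = 0
    rw [ContinuousLinearMap.adjoint_inner_left, ← ContinuousLinearMap.comp_apply, h a ha,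
      ContinuousLinearMap.comp_apply, sub_self]
  have h2 : ⟪ContinuousLinearMap.adjoint u y, (f m).1 x⟫_ℂ - ⟪y, (g m).1 (u x)⟫_ℂ = 0 :=
    congrArg (fun ψ : (generated s).toStarSubalgebra →ₗ[ℂ] ℂ => ψ m) h0
  rw [ContinuousLinearMap.adjoint_inner_left, sub_eq_zero] at h2
  exact h2

end Morphisms

/-! ### Small faithful representations -/

section SmallRep

variable {H K L X : Type u}
  [NormedAddCommGroup H] [InnerProductSpace ℂ H] [CompleteSpace H]
  [NormedAddCommGroup K] [InnerProductSpace ℂ K] [CompleteSpace K]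
  [NormedAddCommGroup L] [InnerProductSpace ℂ L] [CompleteSpace L]
  [NormedAddCommGroup X] [InnerProductSpace ℂ X] [CompleteSpace X]
  {M : VonNeumannAlgebra H} {N : VonNeumannAlgebra K}

/-- The morphism `m ↦ u m u*` given by a unitary `u`. -/
def ad (M : VonNeumannAlgebra H) {u : H →L[ℂ] H} (hu : u ∈ unitary (H →L[ℂ] H))
    (R : VonNeumannAlgebra H) (hR : ∀ m ∈ M, u * m * star u ∈ R) : Morphism M R :=
  have hu' : ContinuousLinearMap.adjoint (star u) = u := by
    rw [← ContinuousLinearMap.star_eq_adjoint, star_star]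
  have h1 : ContinuousLinearMap.adjoint (star u) ∘L star u = 1 := by
    rw [hu']
    exact (Unitary.mem_iff.1 hu).2
  have h2 : star u ∘L ContinuousLinearMap.adjoint (star u) = 1 := by
    rw [hu']
    exact (Unitary.mem_iff.1 hu).1
  have h3 : ∀ m ∈ M, m ∘L star u ∘L ContinuousLinearMap.adjoint (star u) =
      star u ∘L ContinuousLinearMap.adjoint (star u) ∘L m := by
    intro m _
    rw [h2, ← ContinuousLinearMap.comp_assoc, h2]
    rfl
  Morphism.ofStarAlgHom (compress M _ h1 h3) R
    (fun m => by
      have := hR m.1 m.2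
      rw [mul_assoc] at this
      change ContinuousLinearMap.adjoint (star u) ∘L m.1 ∘L star u ∈ R
      rwa [hu'])
    (continuous_compress M _ h1 h3)

theorem ad_apply (M : VonNeumannAlgebra H) {u : H →L[ℂ] H} (hu : u ∈ unitary (H →L[ℂ] H))
    (R : VonNeumannAlgebra H) (hR) (m : M.toStarSubalgebra) :
    (ad M hu R hR m).1 = u * m.1 * star u := by
  change ContinuousLinearMap.adjoint (star u) ∘L m.1 ∘L star u = _
  rw [← ContinuousLinearMap.star_eq_adjoint, star_star, mul_assoc]
  rfl

theorem commute_iff_of_unitary {u t : H →L[ℂ] H} (hu : u ∈ unitary (H →L[ℂ] H)) :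
    Commute u t ↔ u * t * star u = t := by
  obtain ⟨h1, h2⟩ := Unitary.mem_iff.1 hu
  constructor
  · intro h
    rw [h.eq, mul_assoc, h2, mul_one]
  · intro h
    rw [Commute, SemiconjBy]
    conv_rhs => rw [← h, mul_assoc, h1, mul_one]

theorem opTensor_mem_unitary {u : L →L[ℂ] L} (hu : u ∈ unitary (L →L[ℂ] L)) :
    opTensor u (1 : K →L[ℂ] K) ∈ unitary (HilbertTensor L K →L[ℂ] HilbertTensor L K) := by
  obtain ⟨h1, h2⟩ := Unitary.mem_iff.1 hu
  rw [Unitary.mem_iff, star_opTensor, star_one, opTensor_mul, opTensor_mul, h1, h2, one_mul,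
    opTensor_one]
  exact ⟨rfl, rfl⟩

theorem spatialTensor_le_full (E : VonNeumannAlgebra L) :
    spatialTensor E N ≤ spatialTensor (full L) N :=
  generated_le fun _ ⟨m, _, n, hn, h⟩ => subset_generated _ ⟨m, trivial, n, hn, h⟩

/-- A unitary `u` need not normalize `E`, so the universal property will be applied with `R = B(L)`;
this is what makes conjugation land in `R ⊗ N`. -/
theorem conj_mem_spatialTensor (E : VonNeumannAlgebra L) (u : L →L[ℂ] L)
    {t : HilbertTensor L K →L[ℂ] HilbertTensor L K} (ht : t ∈ spatialTensor E N) :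
    opTensor u 1 * t * star (opTensor u 1) ∈ spatialTensor (full L) N := by
  have h1 : opTensor u 1 ∈ spatialTensor (full L) N :=
    subset_generated _ ⟨u, trivial, 1, one_mem N, rfl⟩
  exact mul_mem (mul_mem h1 (spatialTensor_le_full E ht)) (star_mem h1)

/-- In a free exponential `E` of `M` and `N`, a unitary commutes with `E` as soon as its amplification
commutes with the image of the coevaluation. -/
theorem IsFreeExponential.commute_unitary {E : VonNeumannAlgebra L}
    {ε : Morphism M (spatialTensor E N)} (hE : IsFreeExponential M N E ε) {u : L →L[ℂ] L}
    (hu : u ∈ unitary (L →L[ℂ] L)) (h : ∀ m, Commute (opTensor u 1) (ε m).1) :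
    ∀ e ∈ E, Commute u e := by
  let ρ : ∀ v ∈ unitary (L →L[ℂ] L), Morphism E (full L) := fun v hv =>
    ad E hv (full L) fun _ _ => trivial
  let Φ : ∀ v ∈ unitary (L →L[ℂ] L), Morphism (spatialTensor E N) (spatialTensor (full L) N) :=
    fun v hv => ad _ (opTensor_mem_unitary hv) _ fun _ ht => conj_mem_spatialTensor E v ht
  have hρ : ∀ v hv e, (ρ v hv e).1 = v * e.1 * star v := fun v hv e => ad_apply E hv _ _ e
  have hΦ' : ∀ v hv t, (Φ v hv t).1 = opTensor v 1 * t.1 * star (opTensor v 1) :=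
    fun v hv t => ad_apply _ (opTensor_mem_unitary hv) _ _ t
  have hΦ : ∀ v hv, IsTensorId N (ρ v hv) (Φ v hv) := by
    intro v hv e n
    apply Subtype.ext
    rw [hΦ' v hv]
    simp only [elemTensor, hρ, star_opTensor, opTensor_mul, star_one, one_mul, mul_one]
  -- Conjugation by `1` is just the inclusion. As `u ⊗ 1` commutes with the image of `ε`,
  -- conjugation by `u` solves the same universal problem.
  obtain ⟨ρ₀, -, huniq⟩ := hE L (full L) ((Φ 1 (one_mem _)).comp ε)
  have h1 := huniq (ρ 1 (one_mem _)) ⟨Φ 1 (one_mem _), hΦ _ _, fun m => rfl⟩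
  have h2 := huniq (ρ u hu) ⟨Φ u hu, hΦ _ _, fun m => by
    apply Subtype.ext
    change (Φ 1 (one_mem _) (ε m)).1 = _
    rw [hΦ' u hu, hΦ' 1 (one_mem _), star_opTensor 1, star_one, star_one, opTensor_one, one_mul,
      mul_one, eq_comm]
    rw [← commute_iff_of_unitary (opTensor_mem_unitary hu)]
    exact h m⟩
  intro e he
  have h3 : (ρ u hu ⟨e, he⟩).1 = (ρ 1 (one_mem _) ⟨e, he⟩).1 := by rw [h1, h2]
  rw [hρ, hρ, star_one, one_mul, mul_one] at h3
  exact (commute_iff_of_unitary hu).2 h3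

/-- The slices of the coevaluation of a dense subset generate a free exponential. -/
theorem IsFreeExponential.commute_of_slice {E : VonNeumannAlgebra L}
    {ε : Morphism M (spatialTensor E N)} (hE : IsFreeExponential M N E ε)
    {κ : Type*} (c : HilbertBasis κ ℂ K) {D : Set M.toStarSubalgebra}
    (hD : @Dense _ (weakStar M) D) (hDs : ∀ d ∈ D, star d ∈ D) {b : L →L[ℂ] L}
    (hb : ∀ d ∈ D, ∀ j j', Commute b (slice (c j) (c j') (ε d).1)) {e : L →L[ℂ] L} (he : e ∈ E) :
    Commute b e := by
  -- The universal property only speaks about unitaries; the reduction to them needs a star-closed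
  -- set of blocks, which is why `D` is star-closed.
  refine commute_of_unitary (S := {a | ∃ d ∈ D, ∃ j j', a = slice (c j) (c j') (ε d).1}) ?_ ?_ ?_
  · rintro _ ⟨d, hd, j, j', rfl⟩
    exact ⟨star d, hDs d hd, j', j, by rw [star_slice, ε.coe_star]⟩
  · intro u hu h
    refine hE.commute_unitary hu (fun m => ?_) e he
    refine intertwines_of_dense hD (f := ε) (g := ε) (fun d hd => ?_) m
    exact (commute_opTensor_of_slice c fun j j' => (h _ ⟨d, hd, j, j', rfl⟩).symm).symm
  · rintro _ ⟨d, hd, j, j', rfl⟩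
    exact hb d hd j j'

/-- The restriction of a von Neumann algebra to an invariant closed subspace. -/
def restrictRep (E : VonNeumannAlgebra L) (V : Submodule ℂ L) [CompleteSpace V]
    (hV : ∀ e ∈ E, ∀ x ∈ V, e x ∈ V) : Rep E :=
  have h1 : ContinuousLinearMap.adjoint V.subtypeL ∘L V.subtypeL = 1 := by
    rw [Submodule.adjoint_subtypeL]
    ext x
    simp
  have h2 : ∀ e ∈ E, e ∘L V.subtypeL ∘L ContinuousLinearMap.adjoint V.subtypeL =
      V.subtypeL ∘L ContinuousLinearMap.adjoint V.subtypeL ∘L e := by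
    intro e he
    rw [Submodule.adjoint_subtypeL]
    exact (commute_starProjection V (hV e he) (hV _ (star_mem he))).symm.eq
  { X := V
    toMorphism := Morphism.ofStarAlgHom (compress E V.subtypeL h1 h2) _ (fun _ => trivial)
      (continuous_compress E V.subtypeL h1 h2) }

theorem restrictRep_op (E : VonNeumannAlgebra L) (V : Submodule ℂ L) [CompleteSpace V]
    (hV : ∀ e ∈ E, ∀ x ∈ V, e x ∈ V) (e : E.toStarSubalgebra) (x : V) :
    ((show V from (restrictRep E V hV).op e x) : L) = e.1 x := by
  change ((ContinuousLinearMap.adjoint V.subtypeL (e.1 x) : V) : L) = _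
  rw [Submodule.adjoint_subtypeL]
  exact V.starProjection_eq_self_iff.2 (hV e.1 e.2 x x.2)

theorem restrictRep_faithful (E : VonNeumannAlgebra L) (V : Submodule ℂ L) [CompleteSpace V]
    (hV : ∀ e ∈ E, ∀ x ∈ V, e x ∈ V) (h : ∀ e ∈ E, (∀ x ∈ V, e x = 0) → e = 0) :
    (restrictRep E V hV).Faithful := by
  intro e e' hee
  apply Subtype.ext
  rw [← sub_eq_zero]
  refine h _ (sub_mem e.2 e'.2) fun x hx => ?_
  rw [sub_apply, sub_eq_zero]
  have h1 := restrictRep_op E V hV e ⟨x, hx⟩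
  rw [hee] at h1
  exact h1.symm.trans (restrictRep_op E V hV e' ⟨x, hx⟩)

theorem closure_span_word_invariant {σ : Type*} {T : σ → L →L[ℂ] L} {ι : Type*} (x : ι → L) (s : σ)
    {V : Submodule ℂ L}
    (hV : V = (Submodule.span ℂ (Set.range fun p : List σ × ι => word T p.1 (x p.2))).topologicalClosure)
    {y : L} (hy : y ∈ V) : T s y ∈ V := by
  have hVc : IsClosed (V : Set L) := hV ▸ Submodule.isClosed_topologicalClosure _
  have h : V ≤ V.comap (T s).toLinearMap := by
    conv_lhs => rw [hV]
    refine Submodule.topologicalClosure_minimal _ (Submodule.span_le.2 ?_)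
      (hVc.preimage (T s).continuous)
    rintro _ ⟨⟨w, i⟩, rfl⟩
    rw [SetLike.mem_coe, Submodule.mem_comap, hV]
    exact Submodule.le_topologicalClosure _ (Submodule.subset_span ⟨(s :: w, i), rfl⟩)
  exact h hy

/-- A von Neumann algebra whose commutant contains the commutant of `κ` operators has a faithful
representation of dimension at most `2 ^ κ`. -/
theorem exists_faithful_rep (E : VonNeumannAlgebra L) {σ : Type u} (T : σ → L →L[ℂ] L)
    {inv : σ → σ} (hT : ∀ s, T (inv s) = star (T s))
    (hcomm : ∀ b, (∀ s, Commute b (T s)) → ∀ e ∈ E, Commute b e) {κ : Cardinal.{u}}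
    (hκ : ℵ₀ ≤ κ) (hσ : #σ ≤ κ) : ∃ π : Rep E, π.Faithful ∧ π.dim ≤ 2 ^ κ := by
  -- One representative vector is kept for each moment functional that occurs; `V` is the closed
  -- span of their orbits.
  let R : Set (List σ → ℂ) := Set.range (moment T)
  let r : R → L := fun i => i.2.choose
  have hr : ∀ i, moment T (r i) = i := fun i => i.2.choose_spec
  generalize hV : (Submodule.span ℂ
    (Set.range fun p : List σ × R => word T p.1 (r p.2))).topologicalClosure = V
  have hVc : IsClosed (V : Set L) := hV ▸ Submodule.isClosed_topologicalClosure _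
  have hVs : CompleteSpace V := hVc.completeSpace_coe
  have hmem : ∀ p : List σ × R, word T p.1 (r p.2) ∈ V := fun p =>
    hV ▸ Submodule.le_topologicalClosure _ (Submodule.subset_span ⟨p, rfl⟩)
  have hinv : ∀ s, ∀ x ∈ V, T s x ∈ V := fun s x hx =>
    closure_span_word_invariant r s hV.symm hx
  have hP : ∀ e ∈ E, Commute V.starProjection e := hcomm _ fun s =>
    commute_starProjection V (hinv s) (by rw [← hT]; exact hinv _)
  have hVE : ∀ e ∈ E, ∀ x ∈ V, e x ∈ V := by
    intro e he x hx
    have h1 := congrArg (fun S => S x) (hP e he).eq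
    simp only [mul_apply_eq_comp, Submodule.starProjection_eq_self_iff.2 hx] at h1
    exact Submodule.starProjection_eq_self_iff.1 h1
  refine ⟨restrictRep E V hVE, restrictRep_faithful E V hVE ?_, ?_⟩
  · intro e he h0
    ext x
    -- An intertwiner `u` carries the representative with the same moments to `x`. It commutes with
    -- `e`, so `e` kills `x` once it kills the representative.
    let i : R := ⟨moment T x, x, rfl⟩
    obtain ⟨u, hu, huT⟩ := exists_intertwiner_of_moment hT hT (hr i)
    have h1 : u (e (r i)) = e (u (r i)) :=
      congrArg (fun S => S (r i)) (hcomm u huT e he).eq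
    rw [hu, h0 _ (by simpa [word_nil] using hmem ([], i)), map_zero] at h1
    exact h1.symm
  · have h2 : ℵ₀ ≤ 2 ^ κ := hκ.trans (Cardinal.cantor κ).le
    refine hilbertDim_le (X := V) (fun p => ⟨word T p.1 (r p.2), hmem p⟩) ?_ h2 ?_
    · rw [← Submodule.dense_iff_topologicalClosure_eq_top]
      intro x
      rw [Topology.IsInducing.subtypeVal.closure_eq_preimage_closure_image]
      have h1 : ((↑) : V → L) '' (Submodule.span ℂ (Set.range fun p : List σ × R =>
          (⟨word T p.1 (r p.2), hmem p⟩ : V)) : Set V) =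
          (Submodule.span ℂ (Set.range fun p : List σ × R => word T p.1 (r p.2)) : Set L) := by
        have h3 := Submodule.map_span V.subtype
          (Set.range fun p : List σ × R => (⟨word T p.1 (r p.2), hmem p⟩ : V))
        rw [← Set.range_comp] at h3
        exact congrArg (fun S : Submodule ℂ L => (S : Set L)) h3
      refine (Set.ext_iff.1 (congrArg closure h1) x.1).2 ?_
      rw [← Submodule.topologicalClosure_coe, hV]
      exact x.2
    · rw [Cardinal.mk_prod, Cardinal.lift_id, Cardinal.lift_id]
      exact Cardinal.mul_le_of_le h2 ((mk_list_le hκ hσ).trans (Cardinal.cantor κ).le)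
        ((Cardinal.mk_set_le R).trans (mk_word_functional_le hκ hσ))

end SmallRep

/-! ### The upper bound for free exponentials -/

section UpperBound

variable {H K L : Type u}
  [NormedAddCommGroup H] [InnerProductSpace ℂ H] [CompleteSpace H]
  [NormedAddCommGroup K] [InnerProductSpace ℂ K] [CompleteSpace K]
  [NormedAddCommGroup L] [InnerProductSpace ℂ L] [CompleteSpace L]
  {M : VonNeumannAlgebra H} {N : VonNeumannAlgebra K}

theorem hilbertDim_eq_zero_iff : hilbertDim H = 0 ↔ Subsingleton H := by
  obtain ⟨ι, ⟨b⟩⟩ := exists_basis H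
  rw [← mk_eq_hilbertDim b, Cardinal.mk_eq_zero_iff]
  constructor
  · intro h
    refine ⟨fun x y => ext_inner_hilbertBasis b fun i => h.elim i⟩
  · intro h
    refine ⟨fun i => ?_⟩
    have h1 := b.orthonormal.1 i
    rw [Subsingleton.elim (b i) 0, norm_zero] at h1
    exact zero_ne_one h1

/-- A von Neumann algebra commuting with all unitaries has a faithful representation of dimension at
most one. -/
theorem exists_faithful_rep_of_scalar (E : VonNeumannAlgebra L)
    (hE : ∀ u ∈ unitary (L →L[ℂ] L), ∀ e ∈ E, Commute u e) :
    ∃ π : Rep E, π.Faithful ∧ π.dim ≤ 1 := by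
  have hcomm : ∀ b, ∀ e ∈ E, Commute b e := fun b e he =>
    commute_of_unitary (S := ∅) (by simp) (fun u hu _ => hE u hu e he) (by simp)
  rcases subsingleton_or_nontrivial L with hL | hL
  · have hV : ∀ e ∈ E, ∀ x ∈ (⊥ : Submodule ℂ L), e x ∈ (⊥ : Submodule ℂ L) := fun e _ x _ => by
      simp [Subsingleton.elim (e x) 0]
    refine ⟨restrictRep E ⊥ hV, restrictRep_faithful E ⊥ hV fun e _ _ => ?_, ?_⟩
    · ext x
      exact Subsingleton.elim _ _
    · have h0 : hilbertDim (⊥ : Submodule ℂ L) = 0 := hilbertDim_eq_zero_iff.2 inferInstance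
      exact h0.le.trans zero_le_one
  · obtain ⟨x, hx⟩ := exists_ne (0 : L)
    -- Commuting with the rank-one operator `z ↦ ⟪x, z⟫ y` forces `e` to be a scalar.
    have key : ∀ e ∈ E, ∀ y, ⟪x, x⟫_ℂ • e y = ⟪x, e x⟫_ℂ • y := by
      intro e he y
      have h := congrArg (fun S => S x) (hcomm ((innerSL ℂ x).smulRight y) e he).eq
      simp only [mul_apply_eq_comp, ContinuousLinearMap.smulRight_apply, innerSL_apply_apply,
        map_smul] at h
      exact h.symm
    have hxx : ⟪x, x⟫_ℂ ≠ 0 := inner_self_ne_zero.2 hx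
    have hV : ∀ e ∈ E, ∀ y ∈ Submodule.span ℂ {x}, e y ∈ Submodule.span ℂ {x} := by
      intro e he y hy
      have h : e y = (⟪x, x⟫_ℂ)⁻¹ • ⟪x, e x⟫_ℂ • y := by rw [← key e he, inv_smul_smul₀ hxx]
      rw [h]
      exact Submodule.smul_mem _ _ (Submodule.smul_mem _ _ hy)
    have : FiniteDimensional ℂ (Submodule.span ℂ {x}) := inferInstance
    have : CompleteSpace (Submodule.span ℂ {x}) := FiniteDimensional.complete ℂ _
    refine ⟨restrictRep E (Submodule.span ℂ {x}) hV, restrictRep_faithful E _ hV ?_, ?_⟩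
    · intro e he h
      ext y
      have h1 := key e he y
      rw [h x (Submodule.mem_span_singleton_self x), inner_zero_right, zero_smul] at h1
      simpa [hx] using h1
    · obtain ⟨ι, ⟨b⟩⟩ := exists_basis (Submodule.span ℂ {x})
      have h1 : #ι ≤ 1 := by
        have h2 := b.orthonormal.linearIndependent.cardinal_le_rank
        refine h2.trans ?_
        rw [← Module.finrank_eq_rank, finrank_span_singleton hx, Nat.cast_one]
      rw [mk_eq_hilbertDim b] at h1
      exact h1

/-- A free exponential of von Neumann algebras on `H` and `K` has a faithful representation of
dimension at most `2 ^ (ℵ₀ * dim H * dim K)`. -/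
theorem IsFreeExponential.exists_faithful_rep {E : VonNeumannAlgebra L}
    {ε : Morphism M (spatialTensor E N)} (hE : IsFreeExponential M N E ε) :
    ∃ π : Rep E, π.Faithful ∧ π.dim ≤ 2 ^ (ℵ₀ * hilbertDim H * hilbertDim K) := by
  have hone : (1 : Cardinal.{u}) ≤ 2 ^ (ℵ₀ * hilbertDim H * hilbertDim K) :=
    Cardinal.one_le_iff_pos.2 (Cardinal.power_pos _ two_pos)
  -- The degenerate case: if `L ⊗ K = 0`, every amplified unitary commutes with the image of `ε`, so
  -- `E` is scalar and dimension one suffices. This covers `H = 0` and `K = 0`, where the dense set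
  -- argument is unavailable.
  have hdeg : (∀ x : HilbertTensor L K, x = 0) →
      ∃ π : Rep E, π.Faithful ∧ π.dim ≤ 2 ^ (ℵ₀ * hilbertDim H * hilbertDim K) := by
    intro h0
    obtain ⟨π, hπ, hd⟩ := exists_faithful_rep_of_scalar E fun u hu =>
      hE.commute_unitary hu fun m => ContinuousLinearMap.ext fun x => by
        rw [h0 x, map_zero, map_zero]
    exact ⟨π, hπ, hd.trans hone⟩
  rcases subsingleton_or_nontrivial K with hK | hK
  · refine hdeg fun x => ?_
    have : (ContinuousLinearMap.id ℂ (HilbertTensor L K)) = 0 := ext_tmulRight fun x y => by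
      rw [Subsingleton.elim y 0, show tmulRight L (0 : K) = 0 by simp [tmulRight]]
      simp
    exact congrArg (fun S => S x) this
  rcases subsingleton_or_nontrivial H with hH | hH
  · refine hdeg fun x => ?_
    -- On `H = 0` one has `0 = 1` in `M`, and the unital `ε` carries this to `L ⊗ K`.
    have h1 : (0 : M.toStarSubalgebra) = 1 := Subtype.ext
      (ContinuousLinearMap.ext fun x => Subsingleton.elim _ _)
    have h2 : (ε 0).1 = 0 := congrArg Subtype.val (map_zero ε.hom)
    rw [h1, ε.coe_one] at h2
    exact congrArg (fun S => S x) h2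
  obtain ⟨ι, ⟨b⟩⟩ := exists_basis H
  obtain ⟨κ, ⟨c⟩⟩ := exists_basis K
  have hι : Nonempty ι := by
    rw [← Cardinal.mk_ne_zero_iff, mk_eq_hilbertDim b, Ne, hilbertDim_eq_zero_iff]
    exact not_subsingleton H
  have hκ : Nonempty κ := by
    rw [← Cardinal.mk_ne_zero_iff, mk_eq_hilbertDim c, Ne, hilbertDim_eq_zero_iff]
    exact not_subsingleton K
  rw [← mk_eq_hilbertDim b, ← mk_eq_hilbertDim c]
  obtain ⟨D, hDs, hDc, hDd⟩ := exists_dense_set M b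
  have h1 : ℵ₀ ≤ ℵ₀ * #ι * #κ := by
    rw [mul_assoc]
    exact Cardinal.aleph0_le_mul_iff'.2 (.inr ⟨le_rfl, by simp⟩)
  refine WStar.exists_faithful_rep E (σ := D × κ × κ)
    (fun s => slice (c s.2.1) (c s.2.2) (ε s.1.1).1)
    (inv := fun s => (⟨star s.1.1, hDs _ s.1.2⟩, s.2.2, s.2.1)) (fun s => ?_) (fun a ha e he => ?_)
    h1 ?_
  · rw [star_slice, ε.coe_star]
  · exact hE.commute_of_slice c hDd hDs (fun d hd j j' => ha (⟨d, hd⟩, j, j')) he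
  · have h2 : #D ≤ ℵ₀ * #ι * #κ := hDc.trans
      (by simpa using mul_le_mul_right (Cardinal.one_le_iff_ne_zero.2 (Cardinal.mk_ne_zero κ)) _)
    have h3 : #κ ≤ ℵ₀ * #ι * #κ := by
      have : (1 : Cardinal) ≤ ℵ₀ * #ι := Cardinal.one_le_iff_ne_zero.2 (by simp [Cardinal.aleph0_ne_zero])
      simpa using mul_le_mul_left this #κ
    simp only [Cardinal.mk_prod, Cardinal.lift_id]
    exact Cardinal.mul_le_of_le h1 h2 (Cardinal.mul_le_of_le h1 h3 h3)

end UpperBound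

/-! ### Twisting by diagonal unitaries -/

section Twist

/-- The unitary that is diagonal in a Hilbert basis with given eigenvalues. -/
def diagUnitary {X ι : Type*} [NormedAddCommGroup X] [InnerProductSpace ℂ X] [CompleteSpace X]
    (B : HilbertBasis ι ℂ X) (θ : ι → Circle) : X ≃ₗᵢ[ℂ] X :=
  B.repr.trans (HilbertBasis.mk (v := fun i => (θ i : ℂ) • B i)
    (by
      classical
      rw [orthonormal_iff_ite]
      intro i j
      rw [inner_smul_left, inner_smul_right, orthonormal_iff_ite.1 B.orthonormal]
      split_ifs with h
      · subst h
        rw [mul_one, ← Complex.normSq_eq_conj_mul_self]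
        simp
      · simp)
    (by
      rw [← B.dense_span]
      refine Submodule.topologicalClosure_mono (Submodule.span_le.2 ?_)
      rintro _ ⟨i, rfl⟩
      have h : B i = (θ i : ℂ)⁻¹ • (θ i : ℂ) • B i := by
        rw [inv_smul_smul₀ (Circle.coe_ne_zero _)]
      rw [h]
      exact Submodule.smul_mem _ _ (Submodule.subset_span ⟨i, rfl⟩))).repr.symm

theorem diagUnitary_apply {X ι : Type*} [NormedAddCommGroup X] [InnerProductSpace ℂ X]
    [CompleteSpace X] (B : HilbertBasis ι ℂ X) (θ : ι → Circle) (i : ι) :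
    diagUnitary B θ (B i) = (θ i : ℂ) • B i := by
  classical
  rw [diagUnitary, LinearIsometryEquiv.trans_apply, B.repr_self, HilbertBasis.repr_symm_single,
    HilbertBasis.coe_mk]

theorem diagUnitary_symm_apply {X ι : Type*} [NormedAddCommGroup X] [InnerProductSpace ℂ X]
    [CompleteSpace X] (B : HilbertBasis ι ℂ X) (θ : ι → Circle) (i : ι) :
    (diagUnitary B θ).symm (B i) = (θ i : ℂ)⁻¹ • B i := by
  rw [LinearIsometryEquiv.symm_apply_eq, map_smul, diagUnitary_apply,
    inv_smul_smul₀ (Circle.coe_ne_zero _)]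

theorem inner_diagUnitary {X ι : Type*} [NormedAddCommGroup X] [InnerProductSpace ℂ X]
    [CompleteSpace X] (B : HilbertBasis ι ℂ X) (θ : ι → Circle) (i : ι) (x : X) :
    ⟪B i, diagUnitary B θ x⟫_ℂ = θ i * ⟪B i, x⟫_ℂ := by
  have h := (diagUnitary B θ).inner_map_map ((diagUnitary B θ).symm (B i)) x
  rw [LinearIsometryEquiv.apply_symm_apply, diagUnitary_symm_apply, inner_smul_left] at h
  rw [h, ← Circle.coe_inv, ← Circle.coe_inv_eq_conj, inv_inv]

variable {H K : Type u}
  [NormedAddCommGroup H] [InnerProductSpace ℂ H] [CompleteSpace H]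
  [NormedAddCommGroup K] [InnerProductSpace ℂ K] [CompleteSpace K]
  {ι κ : Type u} (b : HilbertBasis ι ℂ H) (c : HilbertBasis κ ℂ K)

/-- A matrix unit of `B(H)` produces the index `i'` from `l`; commuting it past `Q` and taking its
adjoint tests it against `i`. These are the entries of an operator of the form `1 ⊗ Q'`. -/
theorem entry_of_commute_left {Q : HilbertTensor H K →L[ℂ] HilbertTensor H K}
    (hQ : ∀ a, Commute Q (opTensor a 1)) [DecidableEq ι] (l i i' : ι) (j j' : κ) :
    ⟪tensorBasis b c (i, j), Q (tensorBasis b c (i', j'))⟫_ℂ =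
      if i = i' then ⟪tensorBasis b c (l, j), Q (tensorBasis b c (l, j'))⟫_ℂ else 0 := by
  have h0 := orthonormal_iff_ite.1 b.orthonormal
  set a : H →L[ℂ] H := InnerProductSpace.rankOne ℂ (b i') (b l)
  have h1 : tensorBasis b c (i', j') = opTensor a 1 (tensorBasis b c (l, j')) := by
    simp [tensorBasis_apply, opTensor_tmulRight, a, InnerProductSpace.rankOne_apply,
      b.orthonormal.1 l]
  have h2 : star (opTensor a (1 : K →L[ℂ] K)) (tensorBasis b c (i, j)) =
      if i = i' then tensorBasis b c (l, j) else 0 := by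
    rw [star_opTensor, star_one, tensorBasis_apply, opTensor_one_tmulRight,
      ContinuousLinearMap.star_eq_adjoint, InnerProductSpace.adjoint_rankOne,
      InnerProductSpace.rankOne_apply, h0]
    simp only [eq_comm (a := i')]
    split_ifs
    · simp [tensorBasis_apply]
    · simp
  rw [h1, ← mul_apply_eq_comp, (hQ a).eq, mul_apply_eq_comp,
    ← ContinuousLinearMap.adjoint_inner_left, ← ContinuousLinearMap.star_eq_adjoint, h2]
  split_ifs
  · rfl
  · exact inner_zero_left _

theorem entry_of_commute_right {Q : HilbertTensor H K →L[ℂ] HilbertTensor H K}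
    (hQ : ∀ a, Commute Q (opTensor 1 a)) [DecidableEq κ] (i i' : ι) (l j j' : κ) :
    ⟪tensorBasis b c (i, j), Q (tensorBasis b c (i', j'))⟫_ℂ =
      if j = j' then ⟪tensorBasis b c (i, l), Q (tensorBasis b c (i', l))⟫_ℂ else 0 := by
  have h0 := orthonormal_iff_ite.1 c.orthonormal
  set a : K →L[ℂ] K := InnerProductSpace.rankOne ℂ (c j') (c l)
  have h1 : tensorBasis b c (i', j') = opTensor 1 a (tensorBasis b c (i', l)) := by
    simp [tensorBasis_apply, opTensor_tmulRight, a, InnerProductSpace.rankOne_apply,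
      c.orthonormal.1 l]
  have h2 : star (opTensor (1 : H →L[ℂ] H) a) (tensorBasis b c (i, j)) =
      if j = j' then tensorBasis b c (i, l) else 0 := by
    rw [star_opTensor, star_one, tensorBasis_apply, opTensor_tmulRight,
      ContinuousLinearMap.star_eq_adjoint, InnerProductSpace.adjoint_rankOne,
      InnerProductSpace.rankOne_apply, h0]
    simp only [eq_comm (a := j')]
    split_ifs
    · simp [tensorBasis_apply]
    · simp [tmulRight]
  rw [h1, ← mul_apply_eq_comp, (hQ a).eq, mul_apply_eq_comp,
    ← ContinuousLinearMap.adjoint_inner_left, ← ContinuousLinearMap.star_eq_adjoint, h2]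
  split_ifs
  · rfl
  · exact inner_zero_left _

/-- Matrices of phases whose row `i₀` and column `j₀` are trivial. -/
def Phase (i₀ : ι) (j₀ : κ) : Type u :=
  {θ : ι × κ → Circle // (∀ j, θ (i₀, j) = 1) ∧ ∀ i, θ (i, j₀) = 1}

/-- An operator `Q` that commutes with `1 ⊗ B(K)`, such that `D' Q D*` commutes with `B(H) ⊗ 1` for
diagonal unitaries `D ≠ D'` with normalized phases, vanishes; for `D = D'` it is a scalar. -/
theorem eq_smul_one_of_commute {i₀ : ι} {j₀ : κ} (θ θ' : Phase i₀ j₀)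
    {Q G : HilbertTensor H K →L[ℂ] HilbertTensor H K}
    (hG : ∀ x, G x =
      diagUnitary (tensorBasis b c) θ'.1 (Q ((diagUnitary (tensorBasis b c) θ.1).symm x)))
    (hGa : ∀ a, Commute G (opTensor a 1)) (hQ : ∀ a, Commute Q (opTensor 1 a)) :
    ∃ r : ℂ, Q = r • 1 ∧ (θ ≠ θ' → r = 0) := by
  classical
  set B := tensorBasis b c with hB
  have hg : ∀ p p', ⟪B p, G (B p')⟫_ℂ = θ'.1 p * ((θ.1 p' : ℂ)⁻¹ * ⟪B p, Q (B p')⟫_ℂ) := by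
    intro p p'
    rw [hG, inner_diagUnitary, diagUnitary_symm_apply, map_smul, inner_smul_right]
  have hne : ∀ p p', (θ'.1 p : ℂ) * (θ.1 p' : ℂ)⁻¹ ≠ 0 := fun p p' =>
    mul_ne_zero (Circle.coe_ne_zero _) (inv_ne_zero (Circle.coe_ne_zero _))
  set r := ⟪B (i₀, j₀), Q (B (i₀, j₀))⟫_ℂ with hr
  -- The diagonal of `Q` does not depend on `j`, and that of `G` does not depend on `i`. Moving to
  -- row `i₀`, where the phases are trivial, shows that `G` has constant diagonal `r`; column `j₀`
  -- then gives the same for `Q`.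
  have hdiag : ∀ i j, ⟪B (i, j), Q (B (i, j))⟫_ℂ = ⟪B (i, j₀), Q (B (i, j₀))⟫_ℂ := by
    intro i j
    rw [entry_of_commute_right b c hQ i i j₀ j j, if_pos rfl]
  have hdiag' : ∀ i j, θ'.1 (i, j) * ((θ.1 (i, j) : ℂ)⁻¹ * ⟪B (i, j), Q (B (i, j))⟫_ℂ) = r := by
    intro i j
    have h := entry_of_commute_left b c hGa i₀ i i j j
    rw [if_pos rfl, ← hB, hg, hg, θ.2.1, θ'.2.1, hdiag i₀ j] at h
    simpa using h
  have hdiag'' : ∀ i j, ⟪B (i, j), Q (B (i, j))⟫_ℂ = r := by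
    intro i j
    rw [hdiag]
    have h := hdiag' i j₀
    rw [θ.2.2, θ'.2.2] at h
    simpa using h
  refine ⟨r, ?_, ?_⟩
  · refine ext_hilbertBasis B fun p' => ext_inner_hilbertBasis B fun p => ?_
    obtain ⟨i, j⟩ := p
    obtain ⟨i', j'⟩ := p'
    rw [smul_apply, one_apply_eq_self, inner_smul_right,
      orthonormal_iff_ite.1 B.orthonormal]
    by_cases hi : i = i'
    · by_cases hj : j = j'
      · subst hi hj
        rw [hdiag'', if_pos rfl, mul_one]
      · rw [entry_of_commute_right b c hQ i i' j₀ j j', if_neg hj,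
          if_neg fun h => hj (Prod.ext_iff.1 h).2, mul_zero]
    -- For `i ≠ i'` the entry of `G` vanishes, and it is a nonzero multiple of the entry of `Q`.
    · have h := entry_of_commute_left b c hGa i₀ i i' j j'
      rw [if_neg hi, ← hB, hg, ← mul_assoc] at h
      rw [(mul_eq_zero.1 h).resolve_left (hne _ _), if_neg fun h => hi (Prod.ext_iff.1 h).1,
        mul_zero]
  -- The diagonal of `G` now reads `θ' θ⁻¹ r = r`, so `r ≠ 0` forces equal phases.
  · intro hθ
    by_contra hr0
    refine hθ (Subtype.ext (funext fun ⟨i, j⟩ => Circle.ext ?_))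
    have h := hdiag' i j
    rw [hdiag'', ← mul_assoc] at h
    have h1 : (θ'.1 (i, j) : ℂ) * (θ.1 (i, j) : ℂ)⁻¹ = 1 := by
      simpa [hr0] using h
    rw [mul_inv_eq_one₀ (Circle.coe_ne_zero _)] at h1
    exact h1.symm

theorem mk_circle : #Circle = 𝔠 := by
  rw [Circle.argEquiv.cardinal_eq, Cardinal.mk_Ioc_real]
  linarith [Real.pi_pos]

/-- The entries off row `i₀` and column `j₀` are free. With at least two indices on each side,
deleting one at most halves the index set, and the `ℵ₀` in `#Circle = 2 ^ ℵ₀` absorbs this loss. -/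
theorem le_mk_phase (i₀ : ι) (j₀ : κ) (hι : 2 ≤ #ι) (hκ : 2 ≤ #κ) :
    2 ^ (ℵ₀ * #ι * #κ) ≤ #(Phase i₀ j₀) := by
  classical
  let A := {i // i ≠ i₀} × {j // j ≠ j₀}
  have hcard : ∀ (α : Type u) (x₀ : α), 2 ≤ #α → #α ≤ ℵ₀ * #{x // x ≠ x₀} := by
    intro α x₀ hα
    have h1 : #α = #{x // x ≠ x₀} + 1 := by
      have := Cardinal.mk_sum_compl ({x₀} : Set α)
      rw [Cardinal.mk_singleton, add_comm] at this
      exact this.symm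
    have h2 : 1 ≤ #{x // x ≠ x₀} := by
      rw [h1, ← one_add_one_eq_two] at hα
      exact Cardinal.add_le_add_iff_of_lt_aleph0 Cardinal.one_lt_aleph0 |>.1 hα
    calc #α = #{x // x ≠ x₀} + 1 := h1
      _ ≤ #{x // x ≠ x₀} + #{x // x ≠ x₀} := by gcongr
      _ = 2 * #{x // x ≠ x₀} := (two_mul _).symm
      _ ≤ ℵ₀ * #{x // x ≠ x₀} := by
        gcongr
        exact Cardinal.ofNat_lt_aleph0.le
  have hinj : Function.Injective (fun f : A → Circle =>
      (⟨fun p => if h : p.1 ≠ i₀ ∧ p.2 ≠ j₀ then f (⟨p.1, h.1⟩, ⟨p.2, h.2⟩) else 1,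
        fun j => by simp, fun i => by simp⟩ : Phase i₀ j₀)) := by
    intro f f' hf
    funext ⟨⟨i, hi⟩, ⟨j, hj⟩⟩
    have := congrFun (congrArg Subtype.val hf) (i, j)
    simpa [hi, hj] using this
  refine le_trans ?_ (Cardinal.mk_le_of_injective hinj)
  rw [Cardinal.mk_pi, Cardinal.prod_const, mk_circle, Cardinal.lift_continuum,
    Cardinal.lift_uzero, ← Cardinal.two_power_aleph0, ← Cardinal.power_mul]
  refine Cardinal.power_le_power_left two_ne_zero ?_
  rw [Cardinal.mk_prod, Cardinal.lift_id, Cardinal.lift_id]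
  calc ℵ₀ * #ι * #κ ≤ ℵ₀ * (ℵ₀ * #{i // i ≠ i₀}) * (ℵ₀ * #{j // j ≠ j₀}) := by
        gcongr
        · exact hcard ι i₀ hι
        · exact hcard κ j₀ hκ
    _ = (ℵ₀ * ℵ₀ * ℵ₀) * (#{i // i ≠ i₀} * #{j // j ≠ j₀}) := by ring
    _ = ℵ₀ * (#{i // i ≠ i₀} * #{j // j ≠ j₀}) := by
        rw [Cardinal.aleph0_mul_aleph0, Cardinal.aleph0_mul_aleph0]

end Twist

/-! ### Irreducibility -/

section Irreducible

variable {H : Type u} [NormedAddCommGroup H] [InnerProductSpace ℂ H] [CompleteSpace H]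
  {M : VonNeumannAlgebra H}

theorem Rep.op_star (π : Rep M) (m : M.toStarSubalgebra) : π.op (star m) = star (π.op m) :=
  π.toMorphism.coe_star m

/-- A nonzero representation with trivial commutant is irreducible. -/
theorem Rep.irreducible_of_commutant (π : Rep M) [Nontrivial π.X]
    (h : ∀ T : π.X →L[ℂ] π.X, (∀ m, Commute T (π.op m)) → ∃ r : ℂ, T = r • 1) :
    π.Irreducible := by
  refine ⟨inferInstance, fun V hVc hV => ?_⟩
  have : CompleteSpace V := hVc.completeSpace_coe
  obtain ⟨r, hr⟩ := h V.starProjection fun m => commute_starProjection V (hV m) (by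
    rw [← π.op_star]
    exact hV _)
  by_cases hr0 : r = 0
  · refine .inl ((Submodule.eq_bot_iff _).2 fun x hx => ?_)
    rw [← Submodule.starProjection_eq_self_iff.2 hx, hr, hr0]
    simp
  · refine .inr ((Submodule.eq_top_iff').2 fun x => ?_)
    have h1 : V.starProjection x ∈ V := V.starProjection_apply_mem x
    rw [hr, smul_apply, one_apply_eq_self] at h1
    exact (V.smul_mem_iff hr0).1 h1

end Irreducible

/-! ### Irreducible representations of free products -/

section FreeProduct

variable {H K L X Y : Type u}
  [NormedAddCommGroup H] [InnerProductSpace ℂ H] [CompleteSpace H]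
  [NormedAddCommGroup K] [InnerProductSpace ℂ K] [CompleteSpace K]
  [NormedAddCommGroup L] [InnerProductSpace ℂ L] [CompleteSpace L]
  [NormedAddCommGroup X] [InnerProductSpace ℂ X] [CompleteSpace X]
  [NormedAddCommGroup Y] [InnerProductSpace ℂ Y] [CompleteSpace Y]
  {M : VonNeumannAlgebra H} {N : VonNeumannAlgebra K} {F : VonNeumannAlgebra L}
  {i : Morphism M F} {j : Morphism N F}

/-- A unitary that intertwines two representations of a free product on both factors intertwines
them. -/
theorem IsFreeProduct.intertwines (hF : IsFreeProduct M N F i j) {f : Morphism F (full X)}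
    {g : Morphism F (full Y)} (U : X ≃ₗᵢ[ℂ] Y)
    (hi : ∀ m x, U ((f (i m)).1 x) = (g (i m)).1 (U x))
    (hj : ∀ n x, U ((f (j n)).1 x) = (g (j n)).1 (U x)) (e : F.toStarSubalgebra) (x : X) :
    U ((f e).1 x) = (g e).1 (U x) := by
  let f' : Morphism F (full Y) := (conj (full X) U (full Y) fun _ _ => trivial).comp f
  have hf' : ∀ e y, (f' e).1 y = U ((f e).1 (U.symm y)) := fun e y =>
    conj_apply (full X) U (full Y) (fun _ _ => trivial) (f e) y
  -- Both `g` and the conjugate of `f` by `U` restrict to the same pair on the two factors, so the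
  -- coproduct property identifies them.
  obtain ⟨ρ, -, huniq⟩ := hF Y (full Y) (g.comp i) (g.comp j)
  have h1 : g = ρ := huniq g ⟨fun _ => rfl, fun _ => rfl⟩
  have h2 : f' = ρ := huniq f' ⟨fun m => Subtype.ext (ContinuousLinearMap.ext fun y => by
    rw [hf', hi, LinearIsometryEquiv.apply_symm_apply]
    rfl), fun n => Subtype.ext (ContinuousLinearMap.ext fun y => by
    rw [hf', hj, LinearIsometryEquiv.apply_symm_apply]
    rfl)⟩
  rw [h1, ← h2, hf', LinearIsometryEquiv.symm_apply_apply]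

/-- An operator that commutes with both factors of a free product commutes with the free product. -/
theorem IsFreeProduct.commute (hF : IsFreeProduct M N F i j) {f : Morphism F (full X)}
    {T : X →L[ℂ] X} (hi : ∀ m, Commute T (f (i m)).1) (hj : ∀ n, Commute T (f (j n)).1)
    (e : F.toStarSubalgebra) : Commute T (f e).1 := by
  refine commute_of_unitary (S := {a | (∃ m, a = (f (i m)).1) ∨ ∃ n, a = (f (j n)).1}) ?_ ?_ ?_
  · rintro _ (⟨m, rfl⟩ | ⟨n, rfl⟩)
    · exact .inl ⟨star m, by rw [← f.coe_star, ← map_star i.hom]⟩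
    · exact .inr ⟨star n, by rw [← f.coe_star, ← map_star j.hom]⟩
  · intro u hu h
    have h1 := hF.intertwines (f := f) (g := f) (Unitary.linearIsometryEquiv ⟨u, hu⟩)
      (fun m x => congrArg (fun S => S x) (h _ (.inl ⟨m, rfl⟩)).eq)
      (fun n x => congrArg (fun S => S x) (h _ (.inr ⟨n, rfl⟩)).eq) e
    exact ContinuousLinearMap.ext h1
  · rintro _ (⟨m, rfl⟩ | ⟨n, rfl⟩)
    · exact hi m
    · exact hj n

/-- A nonzero vector of an irreducible representation is cyclic for every `*`-closed family of
operators whose commutant is the commutant of the representation. -/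
theorem Rep.Irreducible.dense_span_word {π : Rep F} (hπ : π.Irreducible) {σ : Type*}
    {T : σ → π.X →L[ℂ] π.X} {inv : σ → σ} (hT : ∀ s, T (inv s) = star (T s))
    (hcomm : ∀ b, (∀ s, Commute b (T s)) → ∀ e, Commute b (π.op e)) {x : π.X} (hx : x ≠ 0) :
    (Submodule.span ℂ (Set.range fun w => word T w x)).topologicalClosure = ⊤ := by
  generalize hV : (Submodule.span ℂ (Set.range fun w => word T w x)).topologicalClosure = V
  have hVc : IsClosed (V : Set π.X) := hV ▸ Submodule.isClosed_topologicalClosure _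
  have : CompleteSpace V := hVc.completeSpace_coe
  have hinv : ∀ s, ∀ y ∈ V, T s y ∈ V := fun s y hy => by
    refine closure_span_word_invariant (T := T) (fun _ : Unit => x) s ?_ hy
    rw [← hV]
    congr 2
    ext z
    simp
  have hP := hcomm V.starProjection fun s =>
    commute_starProjection V (hinv s) (by rw [← hT]; exact hinv _)
  have hVE : ∀ e, ∀ y ∈ V, π.op e y ∈ V := by
    intro e y hy
    have h1 := congrArg (fun S => S y) (hP e).eq
    simp only [mul_apply_eq_comp, Submodule.starProjection_eq_self_iff.2 hy] at h1
    exact Submodule.starProjection_eq_self_iff.1 h1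
  refine (hπ.2 V hVc hVE).resolve_left fun hbot => hx ?_
  have hxV : x ∈ V := hV ▸ Submodule.le_topologicalClosure _ (Submodule.subset_span ⟨[], rfl⟩)
  simpa [hbot] using hxV

/-- A free product of von Neumann algebras on `H ≠ 0` and `K ≠ 0` has at most `2 ^ (ℵ₀ * dim H * dim K)`
irreducible representations. -/
theorem IsFreeProduct.mk_irrepClass_le [Nontrivial H] [Nontrivial K]
    (hF : IsFreeProduct M N F i j) : #(IrrepClass F) ≤
      Cardinal.lift.{u + 1} (2 ^ (ℵ₀ * hilbertDim H * hilbertDim K)) := by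
  obtain ⟨ι, ⟨b⟩⟩ := exists_basis H
  obtain ⟨κ, ⟨c⟩⟩ := exists_basis K
  have hι : Nonempty ι := by
    rw [← Cardinal.mk_ne_zero_iff, mk_eq_hilbertDim b, Ne, hilbertDim_eq_zero_iff]
    exact not_subsingleton H
  have hκ : Nonempty κ := by
    rw [← Cardinal.mk_ne_zero_iff, mk_eq_hilbertDim c, Ne, hilbertDim_eq_zero_iff]
    exact not_subsingleton K
  rw [← mk_eq_hilbertDim b, ← mk_eq_hilbertDim c]
  obtain ⟨D, hDs, hDc, hDd⟩ := exists_dense_set M b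
  obtain ⟨D', hDs', hDc', hDd'⟩ := exists_dense_set N c
  -- Since neither dimension is zero, the sum of the two bounds is absorbed by `ℵ₀ * #ι * #κ`.
  let σ := D ⊕ D'
  have h1 : ℵ₀ ≤ ℵ₀ * #ι * #κ := by
    rw [mul_assoc]
    exact Cardinal.aleph0_le_mul_iff'.2 (.inr ⟨le_rfl, by simp⟩)
  have h2 : #D ≤ ℵ₀ * #ι * #κ := hDc.trans
    (by simpa using mul_le_mul_right (Cardinal.one_le_iff_ne_zero.2 (Cardinal.mk_ne_zero κ)) _)
  have h3 : #D' ≤ ℵ₀ * #ι * #κ := hDc'.trans (by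
    rw [mul_right_comm]
    simpa using mul_le_mul_right (Cardinal.one_le_iff_ne_zero.2 (Cardinal.mk_ne_zero ι)) _)
  have hσ : #σ ≤ ℵ₀ * #ι * #κ := by
    rw [Cardinal.mk_sum, Cardinal.lift_id, Cardinal.lift_id]
    exact Cardinal.add_le_of_le h1 h2 h3
  let T : ∀ π : Rep F, σ → π.X →L[ℂ] π.X := fun π =>
    Sum.elim (fun d => π.op (i d.1)) fun d => π.op (j d.1)
  let inv : σ → σ := Sum.map (fun d => ⟨star d.1, hDs _ d.2⟩) fun d => ⟨star d.1, hDs' _ d.2⟩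
  have hT : ∀ (π : Rep F) s, T π (inv s) = star (T π s) := by
    rintro π (d | d)
    · change π.op (i (star d.1)) = star (π.op (i d.1))
      rw [← π.op_star, ← map_star i.hom]
    · change π.op (j (star d.1)) = star (π.op (j d.1))
      rw [← π.op_star, ← map_star j.hom]
  have hcomm : ∀ (π : Rep F) b, (∀ s, Commute b (T π s)) → ∀ e, Commute b (π.op e) := by
    intro π b hb
    refine hF.commute (fun m => ?_) fun n => ?_
    · exact intertwines_of_dense hDd (f := π.toMorphism.comp i) (g := π.toMorphism.comp i)
        (fun d hd => hb (.inl ⟨d, hd⟩)) m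
    · exact intertwines_of_dense hDd' (f := π.toMorphism.comp j) (g := π.toMorphism.comp j)
        (fun d hd => hb (.inr ⟨d, hd⟩)) n
  have hx : ∀ π : {π : Rep F // π.Irreducible}, ∃ x : π.1.X, x ≠ 0 := fun π =>
    have := π.2.1
    exists_ne 0
  choose x hx using hx
  -- The chosen nonzero vectors are cyclic, so equal moments give a unitary that intertwines the
  -- dense sets, then both factors, then `F`.
  have hequiv : ∀ π π' : {π : Rep F // π.Irreducible},
      moment (T π.1) (x π) = moment (T π'.1) (x π') → π.1.UnitarilyEquiv π'.1 := by
    intro π π' h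
    obtain ⟨U, hU⟩ := exists_unitary_of_moment (hT π.1) (hT π'.1) h
      (π.2.dense_span_word (hT π.1) (hcomm π.1) (hx π))
      (π'.2.dense_span_word (hT π'.1) (hcomm π'.1) (hx π'))
    refine ⟨U, hF.intertwines U (fun m y => ?_) fun n y => ?_⟩
    · have h4 := intertwines_of_dense hDd (f := π.1.toMorphism.comp i)
        (g := π'.1.toMorphism.comp i) (u := (U.toContinuousLinearEquiv : π.1.X →L[ℂ] π'.1.X))
        (fun d hd => ContinuousLinearMap.ext (hU (.inl ⟨d, hd⟩))) m
      exact congrArg (fun S => S y) h4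
    · have h4 := intertwines_of_dense hDd' (f := π.1.toMorphism.comp j)
        (g := π'.1.toMorphism.comp j) (u := (U.toContinuousLinearEquiv : π.1.X →L[ℂ] π'.1.X))
        (fun d hd => ContinuousLinearMap.ext (hU (.inr ⟨d, hd⟩))) n
      exact congrArg (fun S => S y) h4
  have hinj : Function.Injective fun q : IrrepClass F => moment (T q.out.1) (x q.out) := by
    intro q q' h
    rw [← q.out_eq, ← q'.out_eq]
    exact Quotient.sound (hequiv _ _ h)
  have h4 := Cardinal.lift_mk_le_lift_mk_of_injective hinj
  rw [Cardinal.lift_id'.{u, u + 1}] at h4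
  exact h4.trans (Cardinal.lift_le.2 (mk_word_functional_le h1 hσ))

/-- The twisted embedding `a ↦ D (1 ⊗ a) D*` of `B(K)` into `B(H ⊗ K)`. -/
def twistRight {ι κ : Type u} (b : HilbertBasis ι ℂ H) (c : HilbertBasis κ ℂ K)
    (θ : ι × κ → Circle) : Morphism (full K) (full (HilbertTensor H K)) :=
  (conj (full (HilbertTensor H K)) (diagUnitary (tensorBasis b c) θ)
    (full (HilbertTensor H K)) fun _ _ => trivial).comp
    (oneTensor H K)

theorem twistRight_apply {ι κ : Type u} (b : HilbertBasis ι ℂ H) (c : HilbertBasis κ ℂ K)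
    (θ : ι × κ → Circle) (a : (full K).toStarSubalgebra) (x : HilbertTensor H K) :
    (twistRight b c θ a).1 x = diagUnitary (tensorBasis b c) θ
      (opTensor 1 a.1 ((diagUnitary (tensorBasis b c) θ).symm x)) :=
  conj_apply (full (HilbertTensor H K)) (diagUnitary (tensorBasis b c) θ)
    (full (HilbertTensor H K)) (fun _ _ => trivial) (oneTensor H K a) x

/-- An intertwiner between twisted pairs of representations of `B(H)` and `B(K)` is a multiple of the
identity if the twists agree, and zero otherwise. -/
theorem eq_zero_or_smul_one_of_twist {ι κ : Type u} (b : HilbertBasis ι ℂ H)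
    (c : HilbertBasis κ ℂ K) {i₀ : ι} {j₀ : κ} (θ θ' : Phase i₀ j₀)
    {G : HilbertTensor H K →L[ℂ] HilbertTensor H K}
    (h : ∀ a, G ∘L (tensorOne H K a).1 = (tensorOne H K a).1 ∘L G)
    (h' : ∀ a, G ∘L (twistRight b c θ.1 a).1 = (twistRight b c θ'.1 a).1 ∘L G) :
    (θ ≠ θ' → G = 0) ∧ (θ = θ' → ∃ r : ℂ, G = r • 1) := by
  set D := diagUnitary (tensorBasis b c) θ.1 with hD
  set D' := diagUnitary (tensorBasis b c) θ'.1 with hD'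
  -- Untwisting: `Q = D'* G D` commutes with `1 ⊗ B(K)`, while `G` commutes with `B(H) ⊗ 1`.
  let Q : HilbertTensor H K →L[ℂ] HilbertTensor H K :=
    (D'.symm.toContinuousLinearEquiv : _ →L[ℂ] _) ∘L G ∘L (D.toContinuousLinearEquiv : _ →L[ℂ] _)
  have hQ : ∀ x, Q x = D'.symm (G (D x)) := fun _ => rfl
  have hGQ : ∀ x, G x = D' (Q (D.symm x)) := fun x => by simp [hQ]
  obtain ⟨r, hr, hr0⟩ := eq_smul_one_of_commute b c θ θ' hGQ (fun a => h ⟨a, trivial⟩) fun a => by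
    refine ContinuousLinearMap.ext fun x => ?_
    have h1 := congrArg (fun S => S (D x)) (h' ⟨a, trivial⟩)
    simp only [ContinuousLinearMap.comp_apply, twistRight_apply, ← hD, ← hD',
      LinearIsometryEquiv.symm_apply_apply] at h1
    rw [mul_apply_eq_comp, mul_apply_eq_comp, hQ, hQ, h1, LinearIsometryEquiv.symm_apply_apply]
  have hG : ∀ x, G x = r • D' (D.symm x) := fun x => by
    rw [hGQ, hr, smul_apply, one_apply_eq_self, map_smul]
  refine ⟨fun hne => ?_, fun heq => ⟨r, ?_⟩⟩
  · ext x
    rw [hG, hr0 hne, zero_smul, zero_apply]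
  · subst heq
    ext x
    rw [hG, ← hD'.trans hD.symm, LinearIsometryEquiv.apply_symm_apply, smul_apply,
      one_apply_eq_self]

/-- A free product of `B(H)` and `B(K)` has at least `2 ^ (ℵ₀ * dim H * dim K)` irreducible
representations. -/
theorem IsFreeProduct.le_mk_irrepClass {i : Morphism (full H) F} {j : Morphism (full K) F}
    (hF : IsFreeProduct (full H) (full K) F i j) (hH : 2 ≤ hilbertDim H) (hK : 2 ≤ hilbertDim K) :
    Cardinal.lift.{u + 1} (2 ^ (ℵ₀ * hilbertDim H * hilbertDim K)) ≤ #(IrrepClass F) := by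
  obtain ⟨ι, ⟨b⟩⟩ := exists_basis H
  obtain ⟨κ, ⟨c⟩⟩ := exists_basis K
  rw [← mk_eq_hilbertDim b] at hH ⊢
  rw [← mk_eq_hilbertDim c] at hK ⊢
  obtain ⟨i₀⟩ : Nonempty ι := Cardinal.mk_ne_zero_iff.1 (two_pos.trans_le hH).ne'
  obtain ⟨j₀⟩ : Nonempty κ := Cardinal.mk_ne_zero_iff.1 (two_pos.trans_le hK).ne'
  choose ρ hρ using fun θ : Phase i₀ j₀ =>
    (hF (HilbertTensor H K) (full _) (tensorOne H K) (twistRight b c θ.1)).exists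
  let π : Phase i₀ j₀ → Rep F := fun θ => { X := HilbertTensor H K, toMorphism := ρ θ }
  have hnt : Nontrivial (HilbertTensor H K) := by
    refine ⟨tensorBasis b c (i₀, j₀), 0, fun h => ?_⟩
    have := (tensorBasis b c).orthonormal.1 (i₀, j₀)
    rw [h, norm_zero] at this
    exact zero_ne_one this
  have key : ∀ (θ θ' : Phase i₀ j₀) (G : HilbertTensor H K →L[ℂ] HilbertTensor H K),
      (∀ e, G ∘L (ρ θ e).1 = (ρ θ' e).1 ∘L G) →
      (θ ≠ θ' → G = 0) ∧ (θ = θ' → ∃ r : ℂ, G = r • 1) := by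
    intro θ θ' G hG
    refine eq_zero_or_smul_one_of_twist b c θ θ' (fun a => ?_) fun a => ?_
    · have := hG (i a)
      rwa [(hρ θ).1, (hρ θ').1] at this
    · have := hG (j a)
      rwa [(hρ θ).2, (hρ θ').2] at this
  have hirr : ∀ θ, (π θ).Irreducible := fun θ =>
    have : Nontrivial (π θ).X := hnt
    (π θ).irreducible_of_commutant fun G hG => (key θ θ G hG).2 rfl
  have hinj : Function.Injective fun θ => (Quotient.mk _ ⟨π θ, hirr θ⟩ : IrrepClass F) := by
    intro θ θ' h
    obtain ⟨U, hU⟩ := Quotient.exact h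
    by_contra hne
    let U' : HilbertTensor H K ≃ₗᵢ[ℂ] HilbertTensor H K := U
    have hU' : ∀ e (x : HilbertTensor H K), U' ((ρ θ e).1 x) = (ρ θ' e).1 (U' x) := hU
    -- A unitary equivalence between different twists would be a zero operator on a nonzero space.
    have h0 := (key θ θ'
      (U'.toContinuousLinearEquiv : HilbertTensor H K →L[ℂ] HilbertTensor H K) fun e =>
      ContinuousLinearMap.ext fun x => hU' e x).1 hne
    obtain ⟨x, hx⟩ := exists_ne (0 : HilbertTensor H K)
    exact hx (U'.map_eq_zero_iff.1 (congrArg (fun S => S x) h0))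
  have h1 := Cardinal.lift_mk_le_lift_mk_of_injective hinj
  rw [Cardinal.lift_id'.{u, u + 1}] at h1
  exact (Cardinal.lift_le.2 (le_mk_phase i₀ j₀ hH hK)).trans h1

end FreeProduct

/-! ### Lower bound for faithful representations of free exponentials -/

section Isotypic

variable {L X Y : Type u}
  [NormedAddCommGroup L] [InnerProductSpace ℂ L] [CompleteSpace L]
  [NormedAddCommGroup X] [InnerProductSpace ℂ X] [CompleteSpace X]
  [NormedAddCommGroup Y] [InnerProductSpace ℂ Y] [CompleteSpace Y]
  {E : VonNeumannAlgebra L} {R : VonNeumannAlgebra X} {S : VonNeumannAlgebra Y}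

/-- A normal representation on a nonzero space has a nonzero intertwiner into the standard space. -/
theorem Morphism.exists_intertwiner_ne_zero [Nontrivial X] (ρ : Morphism E R) :
    ∃ A : X →L[ℂ] L, A ≠ 0 ∧ ∀ e, A ∘L (ρ e).1 = e.1 ∘L A := by
  obtain ⟨x, hx⟩ := exists_ne (0 : X)
  have hadd : ∀ m m', (ρ (m + m')).1 = (ρ m).1 + (ρ m').1 := fun m m' =>
    congrArg Subtype.val (map_add ρ.hom m m')
  have hsmul : ∀ (r : ℂ) m, (ρ (r • m)).1 = r • (ρ m).1 := fun r m =>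
    congrArg Subtype.val (map_smul ρ.hom r m)
  let f : E.toStarSubalgebra →ₗ[ℂ] X :=
    { toFun := fun m => (ρ m).1 x
      map_add' := fun m m' => by rw [hadd, add_apply]
      map_smul' := fun r m => by rw [hsmul, smul_apply, RingHom.id_apply] }
  -- Normality of `ρ` writes its vector state at `x` as `⟪η, (m ⊗ 1) ξ⟫` on `L ⊗ ℓ²`. The aim is
  -- that `(m ⊗ 1)(ξ + η) ↦ ρ(m) x` is well defined and bounded.
  obtain ⟨ξ, η, hφ⟩ := exists_inner_of_continuous ((innerSL ℂ x).toLinearMap ∘ₗ f)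
    (ρ.continuous_inner x x)
  let e : E.toStarSubalgebra →ₗ[ℂ] HilbertTensor L Ell2.{u} :=
    { toFun := fun m => opTensor m.1 1 (ξ + η)
      map_add' := fun m m' => by
        have h1 : (m + m').1 = m.1 + m'.1 := rfl
        rw [h1, opTensor_add_left, add_apply]
      map_smul' := fun r m => by
        have h1 : (r • m).1 = r • m.1 := rfl
        rw [h1, opTensor_smul_left, smul_apply, RingHom.id_apply] }
  have hbound : ∀ m, ‖f m‖ ≤ 1 * ‖e m‖ := by
    intro m
    have h1 : ⟪f m, f m⟫_ℂ =
        ⟪opTensor m.1 (1 : Ell2.{u} →L[ℂ] Ell2.{u}) η, opTensor m.1 1 ξ⟫_ℂ := by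
      have h2 := hφ (star m * m)
      have h3 : (star m * m).1 = star m.1 * m.1 := rfl
      have h4 : opTensor (star m.1) (1 : Ell2.{u} →L[ℂ] Ell2.{u}) =
          star (opTensor m.1 1) := by rw [star_opTensor, star_one]
      rw [h3, opTensor_mul_one_apply, h4, ContinuousLinearMap.star_eq_adjoint,
        ContinuousLinearMap.adjoint_inner_right] at h2
      rw [← h2]
      change ⟪(ρ m).1 x, (ρ m).1 x⟫_ℂ = ⟪x, (ρ (star m * m)).1 x⟫_ℂ
      rw [ρ.coe_mul, ρ.coe_star, mul_apply_eq_comp, ContinuousLinearMap.star_eq_adjoint,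
        ContinuousLinearMap.adjoint_inner_right]
    have h5 : e m = opTensor m.1 1 ξ + opTensor m.1 1 η :=
      map_add (opTensor m.1 (1 : Ell2.{u} →L[ℂ] Ell2.{u})) ξ η
    rw [one_mul, h5]
    set v := opTensor m.1 (1 : Ell2.{u} →L[ℂ] Ell2.{u}) η
    set w := opTensor m.1 (1 : Ell2.{u} →L[ℂ] Ell2.{u}) ξ
    -- Expanding `‖w + v‖ ^ 2`, the cross term alone is `2 ‖f m‖ ^ 2`, so the bound holds with
    -- constant 1.
    have h6 : ‖f m‖ ^ 2 = RCLike.re ⟪w, v⟫_ℂ := by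
      rw [inner_re_symm, ← h1, inner_self_eq_norm_sq]
    have h7 := norm_add_sq (𝕜 := ℂ) w v
    refine le_of_sq_le_sq ?_ (norm_nonneg _)
    nlinarith [sq_nonneg ‖w‖, sq_nonneg ‖v‖, sq_nonneg ‖f m‖]
  obtain ⟨s, hs, hint⟩ := exists_intertwiner e f hbound
  have hcomm : ∀ m : E.toStarSubalgebra, s ∘L opTensor m.1 1 = (ρ m).1 ∘L s := fun m =>
    hint _ _ (fun g => ⟨m * g, opTensor_mul_one_apply _ _ _, by
      change (ρ (m * g)).1 x = (ρ m).1 ((ρ g).1 x)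
      rw [ρ.coe_mul, mul_apply_eq_comp]⟩) fun g => ⟨star m * g, by
      rw [star_opTensor, star_one]
      exact opTensor_mul_one_apply _ _ _⟩
  have hs0 : s ≠ 0 := by
    rintro rfl
    have h1 := hs 1
    rw [zero_apply] at h1
    refine hx ?_
    have h2 : f 1 = x := by
      change (ρ 1).1 x = x
      rw [ρ.coe_one, one_apply_eq_self]
    rw [← h2, ← h1]
  -- A nonzero operator on `L ⊗ ℓ²` is nonzero on some slice `L ⊗ y`. The adjoint of that slice goes
  -- from `X` to `L` as required.
  obtain ⟨y, hy⟩ : ∃ y, s ∘L tmulRight L y ≠ 0 := by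
    by_contra! h
    refine hs0 (ext_tmulRight fun v y => ?_)
    rw [zero_apply, ← ContinuousLinearMap.comp_apply, h, zero_apply]
  refine ⟨ContinuousLinearMap.adjoint (s ∘L tmulRight L y), fun h => hy ?_, fun m => ?_⟩
  · rw [← ContinuousLinearMap.adjoint_adjoint (s ∘L tmulRight L y), h, map_zero]
  · have h1 : (s ∘L tmulRight L y) ∘L (star m).1 = (ρ (star m)).1 ∘L s ∘L tmulRight L y := by
      rw [← ContinuousLinearMap.comp_assoc, ← hcomm]
      ext v
      simp only [ContinuousLinearMap.comp_apply, opTensor_one_tmulRight]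
    have h2 := congrArg ContinuousLinearMap.adjoint h1
    rw [ContinuousLinearMap.adjoint_comp, ContinuousLinearMap.adjoint_comp (ρ (star m)).1,
      ← ContinuousLinearMap.star_eq_adjoint (star m).1,
      ← ContinuousLinearMap.star_eq_adjoint (ρ (star m)).1, ← ρ.coe_star, star_star] at h2
    have h3 : star (star m).1 = m.1 := star_star m.1
    rw [h3] at h2
    exact h2.symm

/-- The closed span of the ranges of all intertwiners of a representation into the standard space. -/
def isotypic (ρ : Morphism E R) : Submodule ℂ L :=
  (Submodule.span ℂ {v | ∃ A : X →L[ℂ] L, (∀ e, A ∘L (ρ e).1 = e.1 ∘L A) ∧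
    ∃ y, A y = v}).topologicalClosure

instance (ρ : Morphism E R) : CompleteSpace (isotypic ρ) :=
  (Submodule.isClosed_topologicalClosure _).completeSpace_coe

theorem isotypic_ne_bot [Nontrivial X] (ρ : Morphism E R) : isotypic ρ ≠ ⊥ := by
  obtain ⟨A, hA, h⟩ := ρ.exists_intertwiner_ne_zero
  intro h0
  refine hA (ContinuousLinearMap.ext fun y => ?_)
  have h1 : A y ∈ isotypic ρ :=
    Submodule.le_topologicalClosure _ (Submodule.subset_span ⟨A, h, y, rfl⟩)
  rw [h0] at h1
  exact h1

/-- Isotypic subspaces are central, in particular their projections lie in the algebra. -/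
theorem starProjection_isotypic_mem (ρ : Morphism E R) : (isotypic ρ).starProjection ∈ E := by
  -- Composing an intertwiner with an operator of the commutant gives another intertwiner;
  -- invariance under the commutant puts the projection in the bicommutant.
  have hinv : ∀ T ∈ E.commutant, ∀ x ∈ isotypic ρ, T x ∈ isotypic ρ := by
    intro T hT x hx
    have h1 : isotypic ρ ≤ (isotypic ρ).comap T.toLinearMap := by
      refine Submodule.topologicalClosure_minimal _ (Submodule.span_le.2 ?_)
        ((Submodule.isClosed_topologicalClosure _).preimage T.continuous)
      rintro _ ⟨A, hA, y, rfl⟩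
      refine Submodule.le_topologicalClosure _ (Submodule.subset_span ⟨T ∘L A, fun e => ?_, y, rfl⟩)
      have h2 : e.1 ∘L T = T ∘L e.1 := VonNeumannAlgebra.mem_commutant_iff.1 hT e.1 e.2
      rw [ContinuousLinearMap.comp_assoc, hA, ← ContinuousLinearMap.comp_assoc, ← h2,
        ContinuousLinearMap.comp_assoc]
    exact h1 hx
  have h1 : (isotypic ρ).starProjection ∈ E.commutant.commutant :=
    VonNeumannAlgebra.mem_commutant_iff.2 fun T hT =>
      (commute_starProjection _ (hinv T hT) (hinv _ (star_mem hT))).eq.symm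
  rwa [E.commutant_commutant] at h1

/-- Isotypic subspaces of disjoint representations are orthogonal. -/
theorem isotypic_isOrtho {ρ : Morphism E R} {σ : Morphism E S}
    (h : ∀ C : X →L[ℂ] Y, (∀ e, C ∘L (ρ e).1 = (σ e).1 ∘L C) → C = 0) :
    isotypic ρ ⟂ isotypic σ := by
  rw [isotypic, isotypic, Submodule.isOrtho_iff_le]
  refine Submodule.topologicalClosure_minimal _ ?_ (Submodule.isClosed_orthogonal _)
  rw [Submodule.orthogonal_closure]
  refine (Submodule.isOrtho_span.2 ?_).le
  rintro _ ⟨A, hA, x, rfl⟩ _ ⟨B, hB, y, rfl⟩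
  -- `B* A` intertwines `ρ` with `σ`, so it vanishes, which says that the ranges of `A` and `B` are
  -- orthogonal.
  have h0 := h (ContinuousLinearMap.adjoint B ∘L A) fun e => by
    have h1 := congrArg ContinuousLinearMap.adjoint (hB (star e))
    rw [ContinuousLinearMap.adjoint_comp, ContinuousLinearMap.adjoint_comp,
      ← ContinuousLinearMap.star_eq_adjoint (star e).1,
      ← ContinuousLinearMap.star_eq_adjoint (σ (star e)).1, ← σ.coe_star, star_star] at h1
    have h3 : star (star e).1 = e.1 := star_star e.1
    rw [h3] at h1
    rw [ContinuousLinearMap.comp_assoc, hA, ← ContinuousLinearMap.comp_assoc, ← h1,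
      ContinuousLinearMap.comp_assoc]
  have h2 := congrArg (fun T => T x) h0
  simp only [ContinuousLinearMap.comp_apply, zero_apply] at h2
  rw [← ContinuousLinearMap.adjoint_inner_left, h2, inner_zero_left]

/-- A faithful representation has dimension at least the number of mutually disjoint nonzero
representations. -/
theorem Rep.Faithful.mk_le_dim {π : Rep E} (hπ : π.Faithful) {ι : Type u} [Nontrivial X]
    (ρ : ι → Morphism E R)
    (h : ∀ i j, i ≠ j → ∀ C : X →L[ℂ] X, (∀ e, C ∘L (ρ i e).1 = (ρ j e).1 ∘L C) → C = 0) :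
    #ι ≤ π.dim := by
  -- The projections `z i` are nonzero and mutually orthogonal in `E`. Faithfulness preserves this,
  -- and a unit vector in each range gives an orthonormal family.
  let z : ι → E.toStarSubalgebra := fun i => ⟨_, starProjection_isotypic_mem (ρ i)⟩
  have hzs : ∀ i, star (z i) = z i := fun i =>
    Subtype.ext (isSelfAdjoint_starProjection (isotypic (ρ i))).star_eq
  have hzm : ∀ i j, i ≠ j → z i * z j = 0 := fun i j hij => Subtype.ext <| by
    change (isotypic (ρ i)).starProjection * (isotypic (ρ j)).starProjection = 0
    refine ContinuousLinearMap.ext fun x => ?_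
    rw [mul_apply_eq_comp, zero_apply]
    exact (Submodule.starProjection_apply_eq_zero_iff _).2
      ((isotypic_isOrtho (h i j hij)).symm.le (Submodule.starProjection_apply_mem _ x))
  have hz0 : ∀ i, π.op (z i) ≠ 0 := by
    intro i h0
    have h1 : π.op 0 = 0 := congrArg Subtype.val (map_zero π.toMorphism.hom)
    have h2 : (isotypic (ρ i)).starProjection = 0 := congrArg Subtype.val (hπ (h0.trans h1.symm))
    refine isotypic_ne_bot (ρ i) ((Submodule.eq_bot_iff _).2 fun x hx => ?_)
    rw [← Submodule.starProjection_eq_self_iff.2 hx, h2, zero_apply]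
  have hv : ∀ i, ∃ v, ‖π.op (z i) v‖ = 1 := by
    intro i
    obtain ⟨v, hv⟩ : ∃ v, π.op (z i) v ≠ 0 := by
      by_contra! h1
      exact hz0 i (ContinuousLinearMap.ext h1)
    refine ⟨((‖π.op (z i) v‖ : ℂ)⁻¹) • v, ?_⟩
    rw [map_smul]
    exact norm_smul_inv_norm hv
  choose v hv using hv
  have horth : Orthonormal ℂ fun i => π.op (z i) (v i) := by
    refine ⟨hv, fun i j hij => ?_⟩
    change ⟪π.op (z i) (v i), π.op (z j) (v j)⟫_ℂ = 0
    rw [← ContinuousLinearMap.adjoint_inner_right, ← ContinuousLinearMap.star_eq_adjoint,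
      ← π.op_star, hzs, ← mul_apply_eq_comp]
    have h1 : π.op (z i * z j) = π.op (z i) * π.op (z j) := π.toMorphism.coe_mul _ _
    have h2 : π.op 0 = 0 := congrArg Subtype.val (map_zero π.toMorphism.hom)
    rw [← h1, hzm i j hij, h2, zero_apply, inner_zero_right]
  have hinj := horth.linearIndependent.injective
  obtain ⟨w, b, hw, -⟩ := horth.toSubtypeRange.exists_hilbertBasis_extension
  rw [Rep.dim, ← mk_eq_hilbertDim b, ← Cardinal.mk_range_eq _ hinj]
  exact Cardinal.mk_le_mk_of_subset hw

end Isotypic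

/-! ### Twisted morphisms out of a free exponential of `B(H)` and `B(K)` -/

section FreeExponential

variable {H K L : Type u}
  [NormedAddCommGroup H] [InnerProductSpace ℂ H] [CompleteSpace H]
  [NormedAddCommGroup K] [InnerProductSpace ℂ K] [CompleteSpace K]
  [NormedAddCommGroup L] [InnerProductSpace ℂ L] [CompleteSpace L]
  {E : VonNeumannAlgebra L}

theorem diagUnitary_one {X ι : Type*} [NormedAddCommGroup X] [InnerProductSpace ℂ X]
    [CompleteSpace X] (B : HilbertBasis ι ℂ X) (x : X) : diagUnitary B 1 x = x := by
  have h := ext_hilbertBasis B (S := ((diagUnitary B 1).toContinuousLinearEquiv : X →L[ℂ] X))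
    (T := 1) fun i => by
      rw [one_apply_eq_self]
      exact (diagUnitary_apply B 1 i).trans (one_smul ℂ _)
  exact congrArg (fun S => S x) h

/-- `B(H) ⊗ B(K) = B(H ⊗ K)`. -/
theorem mem_spatialTensor_full [Nontrivial H] [Nontrivial K]
    (t : HilbertTensor H K →L[ℂ] HilbertTensor H K) : t ∈ spatialTensor (full H) (full K) := by
  obtain ⟨ι, ⟨b⟩⟩ := exists_basis H
  obtain ⟨κ, ⟨c⟩⟩ := exists_basis K
  have hne : ∀ {X ι : Type u} [NormedAddCommGroup X] [InnerProductSpace ℂ X] [Nontrivial X]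
      (b : HilbertBasis ι ℂ X), Nonempty ι := by
    intro X ι _ _ _ b
    by_contra! h
    obtain ⟨x, hx⟩ := exists_ne (0 : X)
    exact hx (ext_inner_hilbertBasis b fun i => (h.false i).elim)
  obtain ⟨i₀⟩ := hne b
  obtain ⟨j₀⟩ := hne c
  rw [spatialTensor, mem_generated_iff]
  · intro Q hQ
    -- With trivial phases on both sides, the twisting lemma says that only scalars commute with
    -- both `B(H) ⊗ 1` and `1 ⊗ B(K)`.
    let θ : Phase i₀ j₀ := ⟨1, fun _ => rfl, fun _ => rfl⟩
    obtain ⟨r, hr, -⟩ := eq_smul_one_of_commute b c θ θ (Q := Q) (G := Q)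
      (fun x => by
        have h1 : (diagUnitary (tensorBasis b c) θ.1).symm x = x := by
          rw [LinearIsometryEquiv.symm_apply_eq]
          exact (diagUnitary_one _ x).symm
        rw [h1]
        exact (diagUnitary_one _ _).symm)
      (fun a => hQ _ ⟨a, trivial, 1, trivial, rfl⟩) fun a => hQ _ ⟨1, trivial, a, trivial, rfl⟩
    rw [hr]
    exact (Commute.one_left t).smul_left r
  · rintro _ ⟨m, -, n, -, rfl⟩
    exact ⟨star m, trivial, star n, trivial, star_opTensor m n⟩

/-- The twisted embedding `a ↦ D* (a ⊗ 1) D` of `B(H)` into `B(H) ⊗ B(K)`. -/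
def twistLeft [Nontrivial H] [Nontrivial K] {ι κ : Type u} (b : HilbertBasis ι ℂ H)
    (c : HilbertBasis κ ℂ K) (θ : ι × κ → Circle) :
    Morphism (full H) (spatialTensor (full H) (full K)) :=
  (conj (full (HilbertTensor H K)) (diagUnitary (tensorBasis b c) θ).symm
    (spatialTensor (full H) (full K)) fun _ _ => mem_spatialTensor_full _).comp (tensorOne H K)

theorem twistLeft_apply [Nontrivial H] [Nontrivial K] {ι κ : Type u} (b : HilbertBasis ι ℂ H)
    (c : HilbertBasis κ ℂ K) (θ : ι × κ → Circle) (a : (full H).toStarSubalgebra)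
    (x : HilbertTensor H K) :
    (twistLeft b c θ a).1 x = (diagUnitary (tensorBasis b c) θ).symm
      (opTensor a.1 1 (diagUnitary (tensorBasis b c) θ x)) :=
  conj_apply (full (HilbertTensor H K)) (diagUnitary (tensorBasis b c) θ).symm
    (spatialTensor (full H) (full K)) (fun _ _ => mem_spatialTensor_full _) (tensorOne H K a) x

/-- If `C` intertwines `ρ` and `σ`, then `C ⊗ 1` intertwines `ρ ⊗ 1` and `σ ⊗ 1`. -/
theorem IsTensorId.intertwines {N : VonNeumannAlgebra K} {R S : VonNeumannAlgebra H}
    {ρ : Morphism E R} {σ : Morphism E S}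
    {Φ : Morphism (spatialTensor E N) (spatialTensor R N)}
    {Ψ : Morphism (spatialTensor E N) (spatialTensor S N)}
    (hΦ : IsTensorId N ρ Φ) (hΨ : IsTensorId N σ Ψ) {C : H →L[ℂ] H}
    (hC : ∀ e, C ∘L (ρ e).1 = (σ e).1 ∘L C) (t : (spatialTensor E N).toStarSubalgebra) :
    opTensor C 1 ∘L (Φ t).1 = (Ψ t).1 ∘L opTensor C 1 := by
  refine intertwines_of_generated (s := {t | ∃ m ∈ E, ∃ n ∈ N, t = opTensor m n}) ?_ ?_ ?_
    (f := Φ) (g := Ψ) ?_ t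
  · rintro _ ⟨m, hm, n, hn, rfl⟩
    exact ⟨star m, star_mem hm, star n, star_mem hn, star_opTensor m n⟩
  · exact ⟨1, one_mem _, 1, one_mem _, opTensor_one.symm⟩
  · rintro _ ⟨m, hm, n, hn, rfl⟩ _ ⟨m', hm', n', hn', rfl⟩
    exact ⟨m * m', mul_mem hm hm', n * n', mul_mem hn hn', opTensor_mul _ _ _ _⟩
  · rintro _ ⟨m, hm, n, hn, rfl⟩
    have h1 : (Φ (elemTensor ⟨m, hm⟩ ⟨n, hn⟩)).1 = opTensor (ρ ⟨m, hm⟩).1 n :=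
      congrArg Subtype.val (hΦ ⟨m, hm⟩ ⟨n, hn⟩)
    have h2 : (Ψ (elemTensor ⟨m, hm⟩ ⟨n, hn⟩)).1 = opTensor (σ ⟨m, hm⟩).1 n :=
      congrArg Subtype.val (hΨ ⟨m, hm⟩ ⟨n, hn⟩)
    have h3 : opTensor C 1 * (Φ (elemTensor ⟨m, hm⟩ ⟨n, hn⟩)).1 =
        (Ψ (elemTensor ⟨m, hm⟩ ⟨n, hn⟩)).1 * opTensor C 1 := by
      rw [h1, h2, opTensor_mul, opTensor_mul, one_mul, mul_one]
      exact congrArg (fun T => opTensor T n) (hC ⟨m, hm⟩)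
    exact h3

/-- Faithful representations of a free exponential of `B(H)` and `B(K)` have dimension at least
`2 ^ (ℵ₀ * dim H * dim K)`. -/
theorem IsFreeExponential.le_dim {ε : Morphism (full H) (spatialTensor E (full K))}
    (hE : IsFreeExponential (full H) (full K) E ε) [Nontrivial H] [Nontrivial K]
    (hH : 2 ≤ hilbertDim H) (hK : 2 ≤ hilbertDim K) {π : Rep E} (hπ : π.Faithful) :
    2 ^ (ℵ₀ * hilbertDim H * hilbertDim K) ≤ π.dim := by
  obtain ⟨ι, ⟨b⟩⟩ := exists_basis H
  obtain ⟨κ, ⟨c⟩⟩ := exists_basis K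
  rw [← mk_eq_hilbertDim b] at hH ⊢
  rw [← mk_eq_hilbertDim c] at hK ⊢
  obtain ⟨i₀⟩ : Nonempty ι := Cardinal.mk_ne_zero_iff.1 (two_pos.trans_le hH).ne'
  obtain ⟨j₀⟩ : Nonempty κ := Cardinal.mk_ne_zero_iff.1 (two_pos.trans_le hK).ne'
  refine (le_mk_phase i₀ j₀ hH hK).trans ?_
  choose ρ hρ using fun θ : Phase i₀ j₀ => (hE H (full H) (twistLeft b c θ.1)).exists
  choose Φ hΦ hε using hρ
  refine hπ.mk_le_dim ρ fun θ θ' hne C hC => ?_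
  set D := diagUnitary (tensorBasis b c) θ.1 with hD
  set D' := diagUnitary (tensorBasis b c) θ'.1 with hD'
  have h1 := (hΦ θ).intertwines (hΦ θ') hC
  -- `C ⊗ 1` commutes with `1 ⊗ B(K)` for free. Since it intertwines the two twists of `B(H)`, which
  -- factor through `ε`, the operator `D' (C ⊗ 1) D*` commutes with `B(H) ⊗ 1`.
  obtain ⟨r, hr, hr0⟩ := eq_smul_one_of_commute b c θ θ' (Q := opTensor C 1)
    (G := (D'.toContinuousLinearEquiv : HilbertTensor H K →L[ℂ] HilbertTensor H K) ∘L
      opTensor C 1 ∘L (D.symm.toContinuousLinearEquiv : HilbertTensor H K →L[ℂ] HilbertTensor H K))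
    (fun x => rfl)
    (fun a => by
      refine ContinuousLinearMap.ext fun x => ?_
      have h2 := congrArg (fun S => S (D.symm x)) (h1 (ε ⟨a, trivial⟩))
      rw [← hε, ← hε] at h2
      simp only [ContinuousLinearMap.comp_apply, twistLeft_apply, ← hD, ← hD',
        LinearIsometryEquiv.apply_symm_apply] at h2
      rw [mul_apply_eq_comp, mul_apply_eq_comp]
      change D' (opTensor C 1 (D.symm (opTensor a 1 x))) =
        opTensor a 1 (D' (opTensor C 1 (D.symm x)))
      rw [h2, LinearIsometryEquiv.apply_symm_apply])
    (fun a => by rw [Commute, SemiconjBy, opTensor_mul, opTensor_mul, one_mul, mul_one, one_mul,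
      mul_one])
  rw [hr0 hne, zero_smul] at hr
  obtain ⟨y, hy⟩ := exists_ne (0 : K)
  refine ContinuousLinearMap.ext fun x => ?_
  have h3 := congrArg (fun T => ‖T (tmulRight H y x)‖) hr
  simp only [opTensor_one_tmulRight, norm_tmulRight, zero_apply, norm_zero, mul_eq_zero,
    norm_eq_zero, hy, or_false] at h3
  exact h3

end FreeExponential

end WStar

end

theorem mainTheorem4 {H K : Type u}
    [NormedAddCommGroup H] [InnerProductSpace ℂ H] [CompleteSpace H]
    [NormedAddCommGroup K] [InnerProductSpace ℂ K] [CompleteSpace K] :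
    -- every free exponential of `M ⊆ B(H)` and `N ⊆ B(K)` has a small faithful representation
    (∀ (M : VonNeumannAlgebra H) (N : VonNeumannAlgebra K)
      (L : Type u) [NormedAddCommGroup L] [InnerProductSpace ℂ L] [CompleteSpace L]
      (E : VonNeumannAlgebra L) (ε : WStar.Morphism M (WStar.spatialTensor E N)),
      WStar.IsFreeExponential M N E ε →
        ∃ π : WStar.Rep E, π.Faithful ∧
          π.dim ≤ 2 ^ (ℵ₀ * WStar.hilbertDim H * WStar.hilbertDim K)) ∧
    (2 ≤ WStar.hilbertDim H → 2 ≤ WStar.hilbertDim K →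
      -- faithful representations of a free exponential of `B(H)` and `B(K)` are large
      (∀ (L : Type u) [NormedAddCommGroup L] [InnerProductSpace ℂ L] [CompleteSpace L]
        (E : VonNeumannAlgebra L)
        (ε : WStar.Morphism (WStar.full H) (WStar.spatialTensor E (WStar.full K))),
        WStar.IsFreeExponential (WStar.full H) (WStar.full K) E ε →
          ∀ π : WStar.Rep E, π.Faithful →
            2 ^ (ℵ₀ * WStar.hilbertDim H * WStar.hilbertDim K) ≤ π.dim) ∧
      -- the number of irreducible representations of a free product of `B(H)` and `B(K)`
      (∀ (L : Type u) [NormedAddCommGroup L] [InnerProductSpace ℂ L] [CompleteSpace L]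
        (F : VonNeumannAlgebra L)
        (i : WStar.Morphism (WStar.full H) F) (j : WStar.Morphism (WStar.full K) F),
        WStar.IsFreeProduct (WStar.full H) (WStar.full K) F i j →
          #(WStar.IrrepClass F) =
            Cardinal.lift.{u + 1} (2 ^ (ℵ₀ * WStar.hilbertDim H * WStar.hilbertDim K)))) := by
  refine ⟨fun M N L _ _ _ E ε hE => hE.exists_faithful_rep, fun hH hK => ?_⟩
  have hnt : ∀ (X : Type u) [NormedAddCommGroup X] [InnerProductSpace ℂ X] [CompleteSpace X],
      2 ≤ WStar.hilbertDim X → Nontrivial X := by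
    intro X _ _ _ hX
    rw [← not_subsingleton_iff_nontrivial, ← WStar.hilbertDim_eq_zero_iff]
    exact (two_pos.trans_le hX).ne'
  have := hnt H hH
  have := hnt K hK
  exact ⟨fun L _ _ _ E ε hE π hπ => hE.le_dim hH hK hπ, fun L _ _ _ F i j hF =>
    le_antisymm hF.mk_irrepClass_le (hF.le_mk_irrepClass hH hK)⟩
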